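/- Let $(X,d)$ be a CAT(0) space with base point $\mathfrak o$ and let $\kappa:[0,\infty)\to[1,\infty)$ be non-decreasing and concave with $\lim_{t\to\infty}\kappa(t)/t=0$; assume moreover that $\kappa^4$ is sublinear, i.e. $\lim_{t\to\infty}\kappa(t)^4/t=0$. Let $b:[0,\infty)\to X$ be a geodesic ray with $b(0)=\mathfrak o$ that is $\kappa$-contracting: there is $C\ge 0$ such that $\operatorname{diam}\pi_b(B)<C\,\kappa(d(\mathfrak o,x))$ for every $x\in X$ and every ball $B$ centred at $x$ with $B\cap b=\emptyset$, where $\pi_b$ is the closest-point projection to $b$. Definitions. For a geodesic $\gamma:I\to X$ on a closed interval $I$ and $[r-\frac12,r+\frac12]$ contained in the interior of $I$, the curtain dual to $\gamma$ at $r$ is $h=\pi_\gamma^{-1}(\gamma[r-\frac12,r+\frac12])$; its half spaces are $h^-=\pi_\gamma^{-1}(\gamma(I\cap(-\infty,r-\frac12)))$ and $h^+=\pi_\gamma^{-1}(\gamma(I\cap(r+\frac12,\infty)))$, and $h$ separates $A$ from $B$ if $A$ and $B$ lie in different half spaces of $h$. A chain is a sequence of pairwise disjoint curtains $h_i$ such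 that $h_i$ separates $h_{i-1}$ from $h_{i+1}$ for all $i$. Two disjoint curtains are $L$-separated if every chain all of whose members meet both of them has cardinality at most $L$; an $L$-chain is a chain whose members are pairwise $L$-separated. Put $d_L(x,x)=0$ and, for $x\ne y$, $d_L(x,y)=1+\max\{|c| : c \text{ an } L\text{-chain each of whose members separates } x \text{ from } y\}$. The curtain model $\widehat X$ is the set $X$ with the metric $\hat d(x,y)=\sum_{L=1}^\infty d_L(x,y)/L^3$. With $(x\cdot y)_{\mathfrak o}=\frac12(\hat d(\mathfrak o,x)+\hat d(\mathfrak o,y)-\hat d(x,y))$, a sequence $(x_i)$ Gromov-converges to infinity if $\liminf_{i,j\to\infty}(x_i\cdot x_j)_{\mathfrak o}=\infty$; two such sequences $(x_i),(y_j)$ are equivalent if $\liminf_{i,j\to\infty}(x_i\cdot y_j)_{\mathfrak o}=\infty$, and $\partial\widehat X$ is the set of equivalence classes. Then $b$ has infinite diameter with respect to $\hat d$. Moreover $b$ defines a point of $\partial\widehat X$: there is exactly one $\xi\in\partial\widehat X$ such that for every sequence $t_n\ge 0$ with $t_n\to\infty$ the sequence $(b(t_n))_n$ Gromov-converges to infinity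 and $[(b(t_n))_n]=\xi$. -/

import Mathlib

open Filter Topology Set
open scoped NNReal ENNReal

namespace CurtainModel

/-- A CAT(0) space: a geodesic metric space in which points on two sides of a geodesic triangle are
at most as far apart as the corresponding points of a comparison triangle in the Euclidean plane.
In a geodesic space `p` lies on some geodesic from `x` to `y` exactly when
`dist x p + dist p y = dist x y`, so `p` and `q` below are arbitrary points on arbitrary geodesic
sides `[x, y]` and `[x, z]`. Any two sides of a triangle share a vertex (and two points on one and
the same side are always at the comparison distance), so all pairs of points are covered. -/
structure IsCAT0 (X : Type*) [MetricSpace X] : Prop where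
  exists_geodesic : ∀ x y : X, ∃ γ : ℝ → X, γ 0 = x ∧ γ (dist x y) = y ∧
    ∀ s ∈ Icc 0 (dist x y), ∀ t ∈ Icc 0 (dist x y), dist (γ s) (γ t) = |s - t|
  comparison : ∀ (x y z p q : X) (x' y' z' p' q' : EuclideanSpace ℝ (Fin 2)),
    dist x' y' = dist x y → dist y' z' = dist y z → dist x' z' = dist x z →
    dist x p + dist p y = dist x y → dist x q + dist q z = dist x z →
    dist x' p' = dist x p → dist p' y' = dist p y →
    dist x' q' = dist x q → dist q' z' = dist q z →
    dist p q ≤ dist p' q'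

section Projection

variable {X : Type*} [MetricSpace X]

/-- `p` is a closest point of `S` to `x`, i.e. `p = π_S(x)`. -/
def IsClosestPoint (S : Set X) (x p : X) : Prop :=
  p ∈ S ∧ ∀ q ∈ S, dist x p ≤ dist x q

/-- The image `π_S(B)` of `B` under closest-point projection to `S`. -/
def projImage (S B : Set X) : Set X :=
  {p | ∃ x ∈ B, IsClosestPoint S x p}

/-- The preimage `π_S⁻¹(A)` of `A` under closest-point projection to `S`. -/
def projPreimage (S A : Set X) : Set X :=
  {x | ∃ p ∈ A, IsClosestPoint S x p}

end Projection

/-- The data of a curtain: a geodesic `γ : I → X` on a closed interval `I` (a segment, a ray or a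
line) and a number `r` such that `[r - 1/2, r + 1/2]` lies in the interior of `I`. Values of `γ`
outside `I` are irrelevant. -/
structure Curtain (X : Type*) [MetricSpace X] where
  I : Set ℝ
  γ : ℝ → X
  r : ℝ
  isClosed : IsClosed I
  ordConnected : I.OrdConnected
  isometric : ∀ s ∈ I, ∀ t ∈ I, dist (γ s) (γ t) = |s - t|
  pole_subset : Icc (r - 1 / 2) (r + 1 / 2) ⊆ interior I

namespace Curtain

variable {X : Type*} [MetricSpace X]

/-- The curtain as a subset of `X`: the preimage of its pole. -/
def carrier (h : Curtain X) : Set X :=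
  projPreimage (h.γ '' h.I) (h.γ '' Icc (h.r - 1 / 2) (h.r + 1 / 2))

/-- The half space `h⁻`. -/
def minus (h : Curtain X) : Set X :=
  projPreimage (h.γ '' h.I) (h.γ '' (h.I ∩ Iio (h.r - 1 / 2)))

/-- The half space `h⁺`. -/
def plus (h : Curtain X) : Set X :=
  projPreimage (h.γ '' h.I) (h.γ '' (h.I ∩ Ioi (h.r + 1 / 2)))

/-- `h` separates `A` from `B`: they lie in different half spaces of `h`. -/
def Separates (h : Curtain X) (A B : Set X) : Prop :=
  (A ⊆ h.minus ∧ B ⊆ h.plus) ∨ (A ⊆ h.plus ∧ B ⊆ h.minus)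

end Curtain

section Metrics

variable {X : Type*} [MetricSpace X]

/-- A chain of `n` curtains: pairwise disjoint, and each one separates its two neighbours.
(Curtains are non-empty, so disjoint ones are distinct and the chain has cardinality `n`.) -/
def IsCurtainChain {n : ℕ} (c : Fin n → Curtain X) : Prop :=
  (∀ i j, i ≠ j → Disjoint (c i).carrier (c j).carrier) ∧
  ∀ i j k : Fin n, (j : ℕ) = i + 1 → (k : ℕ) = j + 1 →
    (c j).Separates (c i).carrier (c k).carrier

/-- Disjoint curtains are `L`-separated if each chain, all of whose members meet both of them, has
cardinality at most `L`. -/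
def LSeparated (L : ℕ) (h k : Curtain X) : Prop :=
  Disjoint h.carrier k.carrier ∧
  ∀ (n : ℕ) (c : Fin n → Curtain X), IsCurtainChain c →
    (∀ i, ((c i).carrier ∩ h.carrier).Nonempty ∧ ((c i).carrier ∩ k.carrier).Nonempty) → n ≤ L

/-- An `L`-chain: a chain whose members are pairwise `L`-separated. -/
def IsLChain (L : ℕ) {n : ℕ} (c : Fin n → Curtain X) : Prop :=
  IsCurtainChain c ∧ ∀ i j, i ≠ j → LSeparated L (c i) (c j)

open Classical in
/-- `d_L(x, y) = 1 + max {|c| : c is an L-chain separating x from y}` for `x ≠ y`, and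
`d_L(x, x) = 0`. (In a CAT(0) space a chain separating `x` from `y` has at most `dist x y`
members, so the maximum exists.) -/
noncomputable def dL (L : ℕ) (x y : X) : ℝ :=
  if x = y then 0
  else 1 + ((sSup {n : ℕ | ∃ c : Fin n → Curtain X,
    IsLChain L c ∧ ∀ i, (c i).Separates {x} {y}} : ℕ) : ℝ)

/-- The metric of the curtain model, `d̂(x, y) = ∑_{L ≥ 1} d_L(x, y) / L³`. -/
noncomputable def dHat (x y : X) : ℝ :=
  ∑' k : ℕ, dL (k + 1) x y / ((k : ℝ) + 1) ^ 3

/-- The diameter of a subset with respect to `d̂`. -/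
noncomputable def diamHat (S : Set X) : ℝ≥0∞ :=
  ⨆ x ∈ S, ⨆ y ∈ S, ENNReal.ofReal (dHat x y)

/-- The Gromov product with respect to `d̂`. -/
noncomputable def gromovProduct (o x y : X) : ℝ :=
  (dHat o x + dHat o y - dHat x y) / 2

/-- `liminf_{i, j → ∞} (x_i · y_j)_o = ∞`. -/
def GromovEquiv (o : X) (x y : ℕ → X) : Prop :=
  Tendsto (fun p : ℕ × ℕ => gromovProduct o (x p.1) (y p.2)) atTop atTop

/-- The sequence `x` Gromov-converges to infinity in the curtain model. -/
def GromovConverges (o : X) (x : ℕ → X) : Prop :=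
  GromovEquiv o x x

/-- The class `[x]` of sequences that Gromov-converge to infinity and are equivalent to `x`. -/
def gromovClass (o : X) (x : ℕ → X) : Set (ℕ → X) :=
  {y | GromovConverges o y ∧ GromovEquiv o x y}

/-- The Gromov boundary of the curtain model: the set of classes of sequences that Gromov-converge
to infinity. -/
def gromovBoundary (o : X) : Set (Set (ℕ → X)) :=
  {ξ | ∃ x : ℕ → X, GromovConverges o x ∧ ξ = gromovClass o x}

end Metrics

/-- A sublinear function `κ : [0, ∞) → [1, ∞)`, monotone and concave. Values at negative numbers
are irrelevant. -/
structure IsSublinear (κ : ℝ → ℝ) : Prop where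
  one_le : ∀ t, 0 ≤ t → 1 ≤ κ t
  monotoneOn : MonotoneOn κ (Ici 0)
  concaveOn : ConcaveOn ℝ (Ici 0) κ
  tendsto : Tendsto (fun t => κ t / t) atTop (𝓝 0)

/-- The subset `b` is `κ`-contracting with respect to the base point `o`: the projection to `b` of
any ball disjoint from `b` and centred at `x` has diameter less than `C * κ (dist o x)`. -/
def IsContracting {X : Type*} [MetricSpace X] (κ : ℝ → ℝ) (o : X) (b : Set X) : Prop :=
  ∃ C : ℝ, 0 ≤ C ∧ ∀ (x : X) (ρ : ℝ), 0 < ρ → Disjoint (Metric.ball x ρ) b →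
    Metric.diam (projImage b (Metric.ball x ρ)) < C * κ (dist o x)

end CurtainModel

/-! Two estimates carry the proof. The first is coarse additivity of `dHat` along every geodesic of
`X`: `dHat_add_le` reverses the triangle inequality at a point of the geodesic, up to a universal
constant. It is proved for each `L` separately: by `LFamily.exists_merge`, families of curtains over
two consecutive segments can be united after discarding `O(L)` members, and the weights `1/L³` make
these losses summable. Consequently moving further out along a ray lowers no Gromov product by more
than a constant (`exists_gromovProduct_bounds`). Once the ray is unbounded for `dHat`, this gives
both convergence and independence of the sequence, without hyperbolicity of the curtain model.

The second estimate is unboundedness, `tendsto_dHat_ray`, where contraction enters. Put `l = A * κ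
t` for a suitable constant `A`. A segment whose projection covers an interval of length `2 * l` of
the ray below time `t` comes within `8 * l` of the ray over that interval
(`LocallyContracting.exists_near`): otherwise it would bend away so sharply that the detour via the
ray is shorter. Hence a curtain meeting two dual curtains whose centres are `4 * l + 2` apart passes
close to the ray between them. A chain of such curtains has points within `O(l)` of each other, so
it has `O(l)` members, and the two dual curtains are `L`-separated with `L = O(l)`. About `t / l`
dual curtains fit between times `0` and `t`, so `dHat` is at least a multiple of `(t / l) / l³`,
that is, of `t / κ t ^ 4`. -/

namespace CurtainModel

/-! ### Comparison inequalities in CAT(0) spaces -/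

section Geometry

variable {X : Type*} [MetricSpace X]

/-- Every triple of points of a metric space has a comparison triangle with one side on the first
coordinate axis. -/
theorem exists_comparison_apex {x y z : X} (hxy : 0 < dist x y) :
    ∃ u v : ℝ, u ^ 2 + v ^ 2 = dist x z ^ 2 ∧ (u - dist x y) ^ 2 + v ^ 2 = dist y z ^ 2 := by
  set a := dist x y
  set b := dist y z
  set c := dist x z
  have hb : 0 ≤ b := dist_nonneg
  have hc : 0 ≤ c := dist_nonneg
  have h1 : a ≤ c + b := by
    have := dist_triangle x z y
    rwa [dist_comm z y] at this
  have h2 : c ≤ a + b := dist_triangle x y z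
  have h3 : b ≤ a + c := by
    have := dist_triangle y x z
    rwa [dist_comm y x] at this
  -- The abscissa comes from the law of cosines. The triangle inequalities give `|u| ≤ c`, so the
  -- square root below has a non-negative argument.
  have hu : 2 * a * ((a ^ 2 + c ^ 2 - b ^ 2) / (2 * a)) = a ^ 2 + c ^ 2 - b ^ 2 := by
    field_simp
  set u := (a ^ 2 + c ^ 2 - b ^ 2) / (2 * a)
  have hle : u ^ 2 ≤ c ^ 2 := by
    have e1 : 0 ≤ c + u := by
      have : 0 ≤ 2 * a * (c + u) := by nlinarith
      exact nonneg_of_mul_nonneg_right this (by positivity)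
    have e2 : 0 ≤ c - u := by
      have : 0 ≤ 2 * a * (c - u) := by nlinarith
      exact nonneg_of_mul_nonneg_right this (by positivity)
    nlinarith
  refine ⟨u, √(c ^ 2 - u ^ 2), ?_, ?_⟩
  · rw [Real.sq_sqrt (by linarith)]; ring
  · rw [Real.sq_sqrt (by linarith)]; linarith

theorem dist_plane (a b c d : ℝ) :
    dist (!₂[a, b] : EuclideanSpace ℝ (Fin 2)) !₂[c, d] = √((a - c) ^ 2 + (b - d) ^ 2) := by
  rw [EuclideanSpace.dist_eq, Fin.sum_univ_two]
  simp [Real.dist_eq, sq_abs]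

/-- Stewart's theorem, as an inequality in a CAT(0) space. -/
theorem IsCAT0.stewart (hX : IsCAT0 X) {x y p : X} (hp : dist x p + dist p y = dist x y) (z : X) :
    dist x y * dist z p ^ 2 ≤ dist p y * dist z x ^ 2 + dist x p * dist z y ^ 2
      - dist x p * dist p y * dist x y := by
  rcases (dist_nonneg (x := x) (y := y)).eq_or_lt with h0 | h0
  · have h1 : dist x p = 0 := by linarith [dist_nonneg (x := x) (y := p), dist_nonneg (x := p) (y := y)]
    have h2 : dist p y = 0 := by linarith
    simp [h1, h2, ← h0]
  obtain ⟨u, v, h1, h2⟩ := exists_comparison_apex (z := z) h0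
  have key := hX.comparison x y z p z !₂[0, 0] !₂[dist x y, 0] !₂[u, v] !₂[dist x p, 0] !₂[u, v]
    (by rw [dist_plane]; simp)
    (by rw [dist_plane, ← Real.sqrt_sq (dist_nonneg (x := y) (y := z)), ← h2]; ring_nf)
    (by rw [dist_plane, ← Real.sqrt_sq (dist_nonneg (x := x) (y := z)), ← h1]; ring_nf)
    hp (by simp) (by rw [dist_plane]; simp)
    (by rw [dist_plane, ← Real.sqrt_sq (dist_nonneg (x := p) (y := y)),
          show dist p y = dist x y - dist x p by linarith]; ring_nf)
    (by rw [dist_plane, ← Real.sqrt_sq (dist_nonneg (x := x) (y := z)), ← h1]; ring_nf)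
    (by simp)
  rw [dist_plane] at key
  have key2 : dist p z ^ 2 ≤ (dist x p - u) ^ 2 + v ^ 2 := by
    have := pow_le_pow_left₀ dist_nonneg key 2
    rw [Real.sq_sqrt (by positivity)] at this
    simpa using this
  rw [dist_comm z p, dist_comm z x, dist_comm z y, ← h1, ← h2]
  have e : dist p y = dist x y - dist x p := by linarith
  rw [e]
  nlinarith [mul_le_mul_of_nonneg_left key2 h0.le]

theorem IsCAT0.exists_between (hX : IsCAT0 X) (x y : X) {s : ℝ} (h0 : 0 ≤ s) (h1 : s ≤ dist x y) :
    ∃ p, dist x p = s ∧ dist p y = dist x y - s := by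
  obtain ⟨γ, g0, g1, g⟩ := hX.exists_geodesic x y
  have hd : (0 : ℝ) ≤ dist x y := dist_nonneg
  refine ⟨γ s, ?_, ?_⟩
  · have := g 0 ⟨le_rfl, hd⟩ s ⟨h0, h1⟩
    rw [g0] at this
    rw [this, zero_sub, abs_neg, abs_of_nonneg h0]
  · have := g s ⟨h0, h1⟩ (dist x y) ⟨hd, le_rfl⟩
    rw [g1] at this
    rw [this, abs_sub_comm, abs_of_nonneg (by linarith)]

/-- The quadrilateral inequality in a CAT(0) space. -/
theorem IsCAT0.quadrilateral (hX : IsCAT0 X) (a b c d : X) :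
    dist a c ^ 2 + dist b d ^ 2 ≤ dist b c ^ 2 + dist a d ^ 2 + 2 * dist a b * dist c d := by
  rcases (dist_nonneg (x := a) (y := b)).eq_or_lt with h | hab
  · rw [dist_eq_zero.1 h.symm]; simp
  rcases (dist_nonneg (x := c) (y := d)).eq_or_lt with h | hcd
  · rw [dist_eq_zero.1 h.symm]; simp; linarith
  set A := dist a b
  set B := dist c d
  have hAB : 0 < A + B := by positivity
  have hac : (0 : ℝ) ≤ dist a c := dist_nonneg
  rcases hac.eq_or_lt with h | hac'
  · have e : a = c := dist_eq_zero.1 h.symm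
    have h1 := dist_triangle b a d
    have h2 : dist b a = A := dist_comm _ _
    have h3 : dist a d = B := by rw [e]
    have h4 : dist b c = A := by rw [← e]; exact h2
    rw [← h, h3, h4]
    rw [h2, h3] at h1
    nlinarith [dist_nonneg (x := b) (y := d)]
  -- Dividing `[a, c]` in the ratio `A : B` makes the final error `2 * A * B` instead of `A² + B²`.
  -- Stewart bounds the distances from `w` to `b` and `d`, and the weighted Cauchy-Schwarz
  -- inequality `r3` combines them.
  obtain ⟨w, hw1, hw2⟩ := hX.exists_between a c (s := A / (A + B) * dist a c) (by positivity)
    (by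
      have : A / (A + B) ≤ 1 := by rw [div_le_one hAB]; linarith
      nlinarith)
  have hw2' : dist w c = B / (A + B) * dist a c := by
    rw [hw2]; field_simp; ring
  have s1 := hX.stewart (x := a) (y := c) (p := w) (by rw [hw1, hw2]; ring) b
  have s2 := hX.stewart (x := a) (y := c) (p := w) (by rw [hw1, hw2]; ring) d
  have tri := dist_triangle b w d
  rw [hw1, hw2'] at s1 s2
  set P := dist b w
  have hQ : dist d w = dist w d := dist_comm _ _
  rw [hQ] at s2
  set Q := dist w d
  rw [dist_comm b a] at s1
  rw [dist_comm d a, dist_comm d c] at s2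
  change _ ≤ _ * A ^ 2 + _ - _ at s1
  change _ ≤ _ + _ * B ^ 2 - _ at s2
  set E := dist a c
  have r1 : (A + B) ^ 2 * P ^ 2 ≤ (A + B) * (B * A ^ 2 + A * dist b c ^ 2) - A * B * E ^ 2 := by
    have : E * ((A + B) ^ 2 * P ^ 2) ≤
        E * ((A + B) * (B * A ^ 2 + A * dist b c ^ 2) - A * B * E ^ 2) := by
      calc E * ((A + B) ^ 2 * P ^ 2) = (A + B) ^ 2 * (E * P ^ 2) := by ring
        _ ≤ (A + B) ^ 2 * _ := mul_le_mul_of_nonneg_left s1 (by positivity)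
        _ = _ := by field_simp
    exact le_of_mul_le_mul_left this hac'
  have r2 : (A + B) ^ 2 * Q ^ 2 ≤ (A + B) * (B * dist a d ^ 2 + A * B ^ 2) - A * B * E ^ 2 := by
    have : E * ((A + B) ^ 2 * Q ^ 2) ≤
        E * ((A + B) * (B * dist a d ^ 2 + A * B ^ 2) - A * B * E ^ 2) := by
      calc E * ((A + B) ^ 2 * Q ^ 2) = (A + B) ^ 2 * (E * Q ^ 2) := by ring
        _ ≤ (A + B) ^ 2 * _ := mul_le_mul_of_nonneg_left s2 (by positivity)
        _ = _ := by field_simp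
    exact le_of_mul_le_mul_left this hac'
  have r3 : A * B * dist b d ^ 2 ≤ (A + B) * (B * P ^ 2 + A * Q ^ 2) := by
    have hb : dist b d ^ 2 ≤ (P + Q) ^ 2 := pow_le_pow_left₀ dist_nonneg tri 2
    nlinarith [mul_le_mul_of_nonneg_left hb (mul_pos hab hcd).le, sq_nonneg (B * P - A * Q)]
  have r4 : (A + B) * (A * B * (E ^ 2 + dist b d ^ 2)) ≤
      (A + B) * (A * B * (dist b c ^ 2 + dist a d ^ 2 + 2 * A * B)) := by
    nlinarith [mul_le_mul_of_nonneg_left r1 hcd.le, mul_le_mul_of_nonneg_left r2 hab.le,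
      mul_le_mul_of_nonneg_left r3 hAB.le]
  exact le_of_mul_le_mul_left (le_of_mul_le_mul_left r4 hAB) (by positivity)

end Geometry

/-! ### Closest-point projection to a geodesic -/

section Foot

variable {X : Type*} [MetricSpace X]

/-- `γ` is a geodesic on the non-empty closed interval `I`. -/
structure IsGeodesicOn (I : Set ℝ) (γ : ℝ → X) : Prop where
  isClosed : IsClosed I
  ordConnected : I.OrdConnected
  nonempty : I.Nonempty
  isometric : ∀ s ∈ I, ∀ t ∈ I, dist (γ s) (γ t) = |s - t|

/-- The parameter of the closest point to `x` on the geodesic `γ : I → X`. -/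
noncomputable def foot (I : Set ℝ) (γ : ℝ → X) (x : X) : ℝ :=
  Classical.epsilon fun t => t ∈ I ∧ ∀ s ∈ I, dist x (γ t) ≤ dist x (γ s)

variable {I : Set ℝ} {γ : ℝ → X}

namespace IsGeodesicOn

theorem continuousOn (hg : IsGeodesicOn I γ) : ContinuousOn γ I := by
  refine LipschitzOnWith.continuousOn (K := 1) (LipschitzOnWith.of_dist_le_mul ?_)
  intro s hs t ht
  rw [hg.isometric s hs t ht, Real.dist_eq]
  simp

theorem exists_closest (hg : IsGeodesicOn I γ) (x : X) :
    ∃ t ∈ I, ∀ s ∈ I, dist x (γ t) ≤ dist x (γ s) := by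
  obtain ⟨t₀, h₀⟩ := hg.nonempty
  set R := 2 * dist x (γ t₀)
  have hc : IsCompact (I ∩ Icc (t₀ - R) (t₀ + R)) := isCompact_Icc.inter_left hg.isClosed
  have hR : 0 ≤ R := by positivity
  obtain ⟨t, ht, hmin⟩ := hc.exists_isMinOn ⟨t₀, h₀, by constructor <;> linarith⟩
    ((continuous_const.dist continuous_id).comp_continuousOn
      (hg.continuousOn.mono inter_subset_left) (f := γ) (g := fun y => dist x y))
  refine ⟨t, ht.1, fun s hs => ?_⟩
  by_cases h : s ∈ Icc (t₀ - R) (t₀ + R)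
  · exact hmin ⟨hs, h⟩
  · have h1 : dist x (γ t) ≤ dist x (γ t₀) := hmin ⟨h₀, by constructor <;> linarith⟩
    have h2 : R < |t₀ - s| := by
      by_contra! hh
      rw [abs_le] at hh
      exact h ⟨by linarith, by linarith⟩
    have h3 := hg.isometric t₀ h₀ s hs
    have h4 := dist_triangle (γ t₀) x (γ s)
    rw [dist_comm (γ t₀) x] at h4
    have : R = 2 * dist x (γ t₀) := rfl
    linarith

theorem foot_spec (hg : IsGeodesicOn I γ) (x : X) :
    foot I γ x ∈ I ∧ ∀ s ∈ I, dist x (γ (foot I γ x)) ≤ dist x (γ s) :=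
  Classical.epsilon_spec (hg.exists_closest x)

theorem foot_mem (hg : IsGeodesicOn I γ) (x : X) : foot I γ x ∈ I := (hg.foot_spec x).1

theorem dist_foot_le (hg : IsGeodesicOn I γ) (x : X) {s : ℝ} (hs : s ∈ I) :
    dist x (γ (foot I γ x)) ≤ dist x (γ s) := (hg.foot_spec x).2 s hs

/-- The angle at a closest point is at least a right angle. If the inequality failed with defect
`D`, Stewart's theorem at the fraction `e` of the way from `γ t` to `γ s` would lower the squared
distance to `x` by at least `e * (D - e * (s - t) ^ 2)`, which is positive for small `e`. -/
theorem pythagoras_of_closest (hX : IsCAT0 X) (hg : IsGeodesicOn I γ) {x : X} {t : ℝ} (ht : t ∈ I)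
    (hmin : ∀ s ∈ I, dist x (γ t) ≤ dist x (γ s)) {s : ℝ} (hs : s ∈ I) :
    dist x (γ t) ^ 2 + (s - t) ^ 2 ≤ dist x (γ s) ^ 2 := by
  by_contra! hlt
  rcases eq_or_ne s t with rfl | hst
  · simp at hlt
  have hpos : 0 < (s - t) ^ 2 := by have := sub_ne_zero.2 hst; positivity
  set D := dist x (γ t) ^ 2 + (s - t) ^ 2 - dist x (γ s) ^ 2
  have hD : 0 < D := by simp only [D]; linarith
  obtain ⟨e, he0, he1, heD⟩ : ∃ e : ℝ, 0 < e ∧ e < 1 ∧ e * (s - t) ^ 2 < D := by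
    refine ⟨min (1 / 2) (D / (2 * (s - t) ^ 2)), by positivity, ?_, ?_⟩
    · exact lt_of_le_of_lt (min_le_left _ _) (by norm_num)
    · calc _ ≤ D / (2 * (s - t) ^ 2) * (s - t) ^ 2 :=
            mul_le_mul_of_nonneg_right (min_le_right _ _) hpos.le
        _ = D / 2 := by field_simp
        _ < D := by linarith
  have hu : t + e * (s - t) ∈ I := by
    have := hg.ordConnected
    rcases le_total t s with h | h
    · exact this.out ht hs ⟨by nlinarith, by nlinarith⟩
    · exact this.out hs ht ⟨by nlinarith, by nlinarith⟩
  have d0 := hg.isometric t ht s hs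
  have d1 : dist (γ t) (γ (t + e * (s - t))) = e * |t - s| := by
    rw [hg.isometric t ht _ hu, show t - (t + e * (s - t)) = e * (t - s) by ring, abs_mul,
      abs_of_pos he0]
  have d2 : dist (γ (t + e * (s - t))) (γ s) = (1 - e) * |t - s| := by
    rw [hg.isometric _ hu s hs, show t + e * (s - t) - s = (1 - e) * (t - s) by ring, abs_mul,
      abs_of_pos (by linarith)]
  have st := hX.stewart (x := γ t) (y := γ s) (p := γ (t + e * (s - t)))
    (by rw [d0, d1, d2]; ring) x
  have hm := pow_le_pow_left₀ dist_nonneg (hmin _ hu) 2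
  rw [d0, d1, d2] at st
  have habs : 0 < |t - s| := abs_pos.2 (sub_ne_zero.2 hst.symm)
  have hsq : |t - s| ^ 2 = (s - t) ^ 2 := by rw [sq_abs]; ring
  have st2 : dist x (γ (t + e * (s - t))) ^ 2 ≤ (1 - e) * dist x (γ t) ^ 2 + e * dist x (γ s) ^ 2
      - e * (1 - e) * (s - t) ^ 2 := by
    rw [← hsq]
    refine le_of_mul_le_mul_left (st.trans (le_of_eq ?_)) habs
    ring
  have : 0 ≤ e * (e * (s - t) ^ 2 - D) := by simp only [D]; linarith
  nlinarith

theorem pythagoras (hX : IsCAT0 X) (hg : IsGeodesicOn I γ) (x : X) {s : ℝ} (hs : s ∈ I) :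
    dist x (γ (foot I γ x)) ^ 2 + (s - foot I γ x) ^ 2 ≤ dist x (γ s) ^ 2 :=
  hg.pythagoras_of_closest hX (hg.foot_mem x) (fun _ h => hg.dist_foot_le x h) hs

theorem foot_eq (hX : IsCAT0 X) (hg : IsGeodesicOn I γ) {x : X} {t : ℝ} (ht : t ∈ I)
    (hmin : ∀ s ∈ I, dist x (γ t) ≤ dist x (γ s)) : foot I γ x = t := by
  have h1 := hg.pythagoras_of_closest hX ht hmin (hg.foot_mem x)
  have h2 := pow_le_pow_left₀ dist_nonneg (hg.dist_foot_le x ht) 2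
  have h3 : (foot I γ x - t) ^ 2 = 0 := le_antisymm (by linarith) (sq_nonneg _)
  exact sub_eq_zero.1 (pow_eq_zero_iff two_ne_zero |>.1 h3)

theorem foot_apply (hX : IsCAT0 X) (hg : IsGeodesicOn I γ) {t : ℝ} (ht : t ∈ I) :
    foot I γ (γ t) = t :=
  hg.foot_eq hX ht fun s _ => by simp

theorem foot_eq_of_between (hX : IsCAT0 X) (hg : IsGeodesicOn I γ) {x w : X}
    (hw : dist x w + dist w (γ (foot I γ x)) = dist x (γ (foot I γ x))) :
    foot I γ w = foot I γ x := by
  refine hg.foot_eq hX (hg.foot_mem x) fun s hs => ?_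
  have := hg.dist_foot_le x hs
  have := dist_triangle x w (γ s)
  linarith

/-- Add the Pythagorean inequalities at the two feet and compare with the quadrilateral inequality:
all squares cancel except that of the distance between the feet. -/
theorem abs_foot_sub_le (hX : IsCAT0 X) (hg : IsGeodesicOn I γ) (x y : X) :
    |foot I γ x - foot I γ y| ≤ dist x y := by
  set s := foot I γ x
  set t := foot I γ y
  have hs : s ∈ I := hg.foot_mem x
  have ht : t ∈ I := hg.foot_mem y
  have h1 := hg.pythagoras hX x ht
  have h2 := hg.pythagoras hX y hs
  have h3 := hX.quadrilateral x y (γ t) (γ s)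
  rw [hg.isometric t ht s hs] at h3
  change dist x (γ s) ^ 2 + (t - s) ^ 2 ≤ _ at h1
  change dist y (γ t) ^ 2 + (s - t) ^ 2 ≤ _ at h2
  have hsq : |t - s| ^ 2 = (t - s) ^ 2 := sq_abs _
  have h4 : |t - s| ^ 2 ≤ dist x y * |t - s| := by nlinarith
  rw [abs_sub_comm]
  rcases (abs_nonneg (t - s)).eq_or_lt with h | h
  · rw [← h]; exact dist_nonneg
  · exact le_of_mul_le_mul_right (by linarith) h

theorem lipschitz_foot (hX : IsCAT0 X) (hg : IsGeodesicOn I γ) : LipschitzWith 1 (foot I γ) :=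
  LipschitzWith.of_dist_le_mul fun x y => by
    simpa [Real.dist_eq] using hg.abs_foot_sub_le hX x y

theorem mem_projPreimage (hX : IsCAT0 X) (hg : IsGeodesicOn I γ) {J : Set ℝ} (hJ : J ⊆ I) {x : X} :
    x ∈ projPreimage (γ '' I) (γ '' J) ↔ foot I γ x ∈ J := by
  constructor
  · rintro ⟨p, ⟨t, ht, rfl⟩, -, h⟩
    rwa [hg.foot_eq hX (hJ ht) fun s hs => h _ (mem_image_of_mem _ hs)]
  · intro h
    refine ⟨γ (foot I γ x), mem_image_of_mem _ h, mem_image_of_mem _ (hJ h), ?_⟩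
    rintro _ ⟨s, hs, rfl⟩
    exact hg.dist_foot_le x hs

theorem mem_projImage (hg : IsGeodesicOn I γ) {B : Set X} {x : X} (hx : x ∈ B) :
    γ (foot I γ x) ∈ projImage (γ '' I) B := by
  refine ⟨x, hx, mem_image_of_mem _ (hg.foot_mem x), ?_⟩
  rintro _ ⟨s, hs, rfl⟩
  exact hg.dist_foot_le x hs

end IsGeodesicOn

theorem IsCAT0.exists_isGeodesicOn (hX : IsCAT0 X) (x y : X) : ∃ α : ℝ → X,
    IsGeodesicOn (Icc 0 (dist x y)) α ∧ α 0 = x ∧ α (dist x y) = y := by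
  obtain ⟨α, h0, h1, h⟩ := hX.exists_geodesic x y
  exact ⟨α, ⟨isClosed_Icc, ordConnected_Icc, ⟨0, left_mem_Icc.2 dist_nonneg⟩, h⟩, h0, h1⟩

/-- A preconnected set containing `x` and `y` all of whose points lie between them. -/
theorem IsCAT0.exists_isPreconnected (hX : IsCAT0 X) (x y : X) : ∃ S : Set X,
    IsPreconnected S ∧ x ∈ S ∧ y ∈ S ∧ ∀ w ∈ S, dist x w + dist w y = dist x y := by
  obtain ⟨α, hα, h0, h1⟩ := hX.exists_isGeodesicOn x y
  refine ⟨α '' Icc 0 (dist x y), isPreconnected_Icc.image _ hα.continuousOn,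
    ⟨0, left_mem_Icc.2 dist_nonneg, h0⟩, ⟨_, right_mem_Icc.2 dist_nonneg, h1⟩, ?_⟩
  rintro _ ⟨s, hs, rfl⟩
  have e0 := hα.isometric 0 (left_mem_Icc.2 dist_nonneg) s hs
  have e1 := hα.isometric s hs _ (right_mem_Icc.2 dist_nonneg)
  rw [h0, abs_sub_comm, abs_of_nonneg (by linarith [hs.1])] at e0
  rw [h1, abs_sub_comm, abs_of_nonneg (by linarith [hs.2])] at e1
  rw [e0, e1]; ring

/-- The segment from a point to its projection stays in one fibre, so any two points are joined
through `γ '' J`. -/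
theorem IsGeodesicOn.isPreconnected_preimage (hX : IsCAT0 X) (hg : IsGeodesicOn I γ) {J : Set ℝ}
    (hJ : J ⊆ I) (hJc : J.OrdConnected) : IsPreconnected {x | foot I γ x ∈ J} := by
  have hγJ : IsPreconnected (γ '' J) :=
    hJc.isPreconnected.image _ (hg.continuousOn.mono hJ)
  have hsub : γ '' J ⊆ {x | foot I γ x ∈ J} := by
    rintro _ ⟨t, ht, rfl⟩
    change foot I γ (γ t) ∈ J
    rwa [hg.foot_apply hX (hJ ht)]
  refine isPreconnected_of_forall_pair fun x hx y hy => ?_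
  obtain ⟨S, hS, xS, pS, hbS⟩ := hX.exists_isPreconnected x (γ (foot I γ x))
  obtain ⟨T, hT, yT, qT, hbT⟩ := hX.exists_isPreconnected y (γ (foot I γ y))
  refine ⟨(S ∪ γ '' J) ∪ T, ?_, .inl (.inl xS), .inr yT, ?_⟩
  · rintro w ((hw | hw) | hw)
    · change foot I γ w ∈ J
      rw [hg.foot_eq_of_between hX (hbS w hw)]; exact hx
    · exact hsub hw
    · change foot I γ w ∈ J
      rw [hg.foot_eq_of_between hX (hbT w hw)]; exact hy
  · exact (hS.union _ pS (mem_image_of_mem _ hx) hγJ).union _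
      (.inr (mem_image_of_mem _ hy)) qT hT

end Foot

/-! ### Curtains, half spaces and their order -/

section Curtains

theorem image_comp_neg {Y : Type*} (γ : ℝ → Y) (A B : Set ℝ) (h : ∀ t, t ∈ A ↔ -t ∈ B) :
    (fun t => γ (-t)) '' A = γ '' B := by
  ext x
  constructor
  · rintro ⟨t, ht, rfl⟩
    exact ⟨-t, (h t).1 ht, rfl⟩
  · rintro ⟨t, ht, rfl⟩
    exact ⟨-t, (h (-t)).2 (by rwa [neg_neg]), by simp⟩

variable {X : Type*} [MetricSpace X]

namespace Curtain

theorem Icc_subset (h : Curtain X) : Icc (h.r - 1 / 2) (h.r + 1 / 2) ⊆ h.I :=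
  h.pole_subset.trans interior_subset

theorem isGeodesicOn (h : Curtain X) : IsGeodesicOn h.I h.γ :=
  ⟨h.isClosed, h.ordConnected, ⟨h.r, h.Icc_subset ⟨by linarith, by linarith⟩⟩, h.isometric⟩

/-- The parameter of the projection to the geodesic defining a curtain, centred at its pole. -/
noncomputable def height (h : Curtain X) (x : X) : ℝ := foot h.I h.γ x - h.r

theorem abs_height_sub_le (hX : IsCAT0 X) (h : Curtain X) (x y : X) :
    |h.height x - h.height y| ≤ dist x y := by
  have := h.isGeodesicOn.abs_foot_sub_le hX x y
  simpa [height] using this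

theorem lipschitz_height (hX : IsCAT0 X) (h : Curtain X) : LipschitzWith 1 h.height :=
  LipschitzWith.of_dist_le_mul fun x y => by
    simpa [Real.dist_eq] using h.abs_height_sub_le hX x y

theorem mem_carrier (hX : IsCAT0 X) (h : Curtain X) {x : X} :
    x ∈ h.carrier ↔ h.height x ∈ Icc (-(1 / 2)) (1 / 2) := by
  rw [carrier, h.isGeodesicOn.mem_projPreimage hX h.Icc_subset, height, mem_Icc, mem_Icc]
  constructor <;> rintro ⟨h1, h2⟩ <;> constructor <;> linarith

theorem mem_minus (hX : IsCAT0 X) (h : Curtain X) {x : X} :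
    x ∈ h.minus ↔ h.height x < -(1 / 2) := by
  rw [minus, h.isGeodesicOn.mem_projPreimage hX inter_subset_left, height]
  exact ⟨fun h1 => by have := h1.2; simp only [mem_Iio] at this; linarith,
    fun h1 => ⟨h.isGeodesicOn.foot_mem x, by simp only [mem_Iio]; linarith⟩⟩

theorem mem_plus (hX : IsCAT0 X) (h : Curtain X) {x : X} :
    x ∈ h.plus ↔ 1 / 2 < h.height x := by
  rw [plus, h.isGeodesicOn.mem_projPreimage hX inter_subset_left, height]
  exact ⟨fun h1 => by have := h1.2; simp only [mem_Ioi] at this; linarith,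
    fun h1 => ⟨h.isGeodesicOn.foot_mem x, by simp only [mem_Ioi]; linarith⟩⟩

theorem nonempty_carrier (hX : IsCAT0 X) (h : Curtain X) : h.carrier.Nonempty := by
  refine ⟨h.γ h.r, (h.mem_carrier hX).2 ?_⟩
  rw [height, h.isGeodesicOn.foot_apply hX (h.Icc_subset ⟨by linarith, by linarith⟩)]
  norm_num

theorem isPreconnected_height (hX : IsCAT0 X) (h : Curtain X) {J : Set ℝ} (hJ : J.OrdConnected) :
    IsPreconnected {x | h.height x ∈ J} := by
  have hJ' : OrdConnected (h.I ∩ {t | t - h.r ∈ J}) := by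
    refine h.ordConnected.inter ⟨fun a ha b hb c hc => hJ.out ha hb ⟨?_, ?_⟩⟩
    · linarith [hc.1]
    · linarith [hc.2]
  convert h.isGeodesicOn.isPreconnected_preimage hX inter_subset_left hJ' using 1
  ext x
  exact ⟨fun hx => ⟨h.isGeodesicOn.foot_mem x, hx⟩, fun hx => hx.2⟩

theorem isPreconnected_carrier (hX : IsCAT0 X) (h : Curtain X) : IsPreconnected h.carrier := by
  convert h.isPreconnected_height hX (J := Icc (-(1 / 2)) (1 / 2)) ordConnected_Icc using 1
  ext x; exact h.mem_carrier hX

theorem isPreconnected_minus_union (hX : IsCAT0 X) (h : Curtain X) :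
    IsPreconnected (h.minus ∪ h.carrier) := by
  convert h.isPreconnected_height hX (J := Iic (1 / 2)) ordConnected_Iic using 1
  ext x
  simp only [mem_union, h.mem_minus hX, h.mem_carrier hX, mem_Icc, mem_Iic, mem_ofPred_eq]
  constructor
  · rintro (h | h)
    · linarith
    · exact h.2
  · intro h1
    by_cases h2 : h.height x < -(1 / 2)
    · exact .inl h2
    · exact .inr ⟨not_lt.1 h2, h1⟩

theorem disjoint_minus_carrier (hX : IsCAT0 X) (h : Curtain X) : Disjoint h.minus h.carrier :=
  disjoint_left.2 fun x h1 h2 => by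
    rw [h.mem_minus hX] at h1
    rw [h.mem_carrier hX] at h2
    linarith [h2.1]

theorem disjoint_minus_plus (hX : IsCAT0 X) (h : Curtain X) : Disjoint h.minus h.plus :=
  disjoint_left.2 fun x h1 h2 => by
    rw [h.mem_minus hX] at h1
    rw [h.mem_plus hX] at h2
    linarith

theorem mem_cases (hX : IsCAT0 X) (h : Curtain X) (x : X) :
    x ∈ h.minus ∨ x ∈ h.carrier ∨ x ∈ h.plus := by
  rw [h.mem_minus hX, h.mem_carrier hX, h.mem_plus hX]
  by_cases h1 : h.height x < -(1 / 2)
  · exact .inl h1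
  by_cases h2 : 1 / 2 < h.height x
  · exact .inr (.inr h2)
  · exact .inr (.inl ⟨not_lt.1 h1, not_lt.1 h2⟩)

/-- A preconnected set with a point outside `h⁺` and a point outside `h⁻` meets the curtain. -/
theorem inter_nonempty (hX : IsCAT0 X) (h : Curtain X) {S : Set X} (hS : IsPreconnected S) {x y : X}
    (hx : x ∈ S) (hy : y ∈ S) (hx' : x ∉ h.plus) (hy' : y ∉ h.minus) :
    (S ∩ h.carrier).Nonempty := by
  rw [h.mem_plus hX, not_lt] at hx'
  rw [h.mem_minus hX, not_lt] at hy'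
  by_cases h1 : -(1 / 2) ≤ h.height x
  · exact ⟨x, hx, (h.mem_carrier hX).2 ⟨h1, hx'⟩⟩
  by_cases h2 : h.height y ≤ 1 / 2
  · exact ⟨y, hy, (h.mem_carrier hX).2 ⟨hy', h2⟩⟩
  obtain ⟨z, hz, hz'⟩ := hS.intermediate_value hx hy (h.lipschitz_height hX).continuous.continuousOn
    (show (0 : ℝ) ∈ Icc _ _ by constructor <;> linarith)
  exact ⟨z, hz, (h.mem_carrier hX).2 (by rw [hz']; norm_num)⟩

theorem subset_plus_of_disjoint (hX : IsCAT0 X) (h : Curtain X) {S : Set X} (hS : IsPreconnected S)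
    (hd : Disjoint S h.carrier) {x : X} (hx : x ∈ S) (hx' : x ∈ h.plus) : S ⊆ h.plus := by
  intro y hy
  by_contra hy'
  exact not_disjoint_iff_nonempty_inter.2 (h.inter_nonempty hX hS hy hx hy'
    ((h.disjoint_minus_plus hX).notMem_of_mem_right hx')) hd

theorem subset_minus_of_disjoint (hX : IsCAT0 X) (h : Curtain X) {S : Set X} (hS : IsPreconnected S)
    (hd : Disjoint S h.carrier) {x : X} (hx : x ∈ S) (hx' : x ∈ h.minus) : S ⊆ h.minus := by
  intro y hy
  by_contra hy'
  exact not_disjoint_iff_nonempty_inter.2 (h.inter_nonempty hX hS hx hy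
    ((h.disjoint_minus_plus hX).notMem_of_mem_left hx') hy') hd

theorem subset_minus_or_subset_plus (hX : IsCAT0 X) (h : Curtain X) {S : Set X}
    (hS : IsPreconnected S) (hd : Disjoint S h.carrier) : S ⊆ h.minus ∨ S ⊆ h.plus := by
  rcases S.eq_empty_or_nonempty with rfl | ⟨x, hx⟩
  · simp
  rcases h.mem_cases hX x with h1 | h1 | h1
  · exact .inl (h.subset_minus_of_disjoint hX hS hd hx h1)
  · exact absurd h1 (disjoint_left.1 hd hx)
  · exact .inr (h.subset_plus_of_disjoint hX hS hd hx h1)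

/-- The same curtain with the geodesic traversed backwards. -/
def flip (h : Curtain X) : Curtain X where
  I := Neg.neg ⁻¹' h.I
  γ t := h.γ (-t)
  r := -h.r
  isClosed := h.isClosed.preimage continuous_neg
  ordConnected := ⟨fun _ ha _ hb _ hc =>
    h.ordConnected.out hb ha ⟨neg_le_neg hc.2, neg_le_neg hc.1⟩⟩
  isometric s hs t ht := by
    rw [h.isometric _ hs _ ht, ← abs_neg]; ring_nf
  pole_subset := by
    rw [show (Neg.neg ⁻¹' h.I) = (Homeomorph.neg ℝ) ⁻¹' h.I from rfl,
      ← (Homeomorph.neg ℝ).preimage_interior]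
    intro t ht
    refine h.pole_subset (show -t ∈ _ from ⟨?_, ?_⟩)
    · linarith [ht.2]
    · linarith [ht.1]

theorem flip_carrier (h : Curtain X) : h.flip.carrier = h.carrier := by
  simp only [carrier, flip]
  rw [image_comp_neg _ (Neg.neg ⁻¹' h.I) h.I (fun _ => Iff.rfl), image_comp_neg]
  intro t
  constructor <;> rintro ⟨h1, h2⟩ <;> constructor <;> linarith

theorem flip_minus (h : Curtain X) : h.flip.minus = h.plus := by
  simp only [minus, plus, flip]
  rw [image_comp_neg _ (Neg.neg ⁻¹' h.I) h.I (fun _ => Iff.rfl), image_comp_neg]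
  intro t
  constructor <;> rintro ⟨h1, h2⟩ <;> refine ⟨h1, ?_⟩ <;> simp only [mem_Iio, mem_Ioi] at * <;>
    linarith

theorem flip_plus (h : Curtain X) : h.flip.plus = h.minus := by
  simp only [minus, plus, flip]
  rw [image_comp_neg _ (Neg.neg ⁻¹' h.I) h.I (fun _ => Iff.rfl), image_comp_neg]
  intro t
  constructor <;> rintro ⟨h1, h2⟩ <;> refine ⟨h1, ?_⟩ <;> simp only [mem_Iio, mem_Ioi] at * <;>
    linarith

theorem flip_flip (h : Curtain X) : h.flip.flip = h := by
  cases h; simp [flip]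

theorem isPreconnected_plus_union (hX : IsCAT0 X) (h : Curtain X) :
    IsPreconnected (h.plus ∪ h.carrier) := by
  have := h.flip.isPreconnected_minus_union hX
  rwa [flip_carrier, flip_minus] at this

/-- `h` lies entirely before `k`. -/
def Precedes (h k : Curtain X) : Prop := h.carrier ⊆ k.minus ∧ k.carrier ⊆ h.plus

/-- The connected set `k⁺ ∪ k` would avoid `h`, hence lie in `h⁺` together with `z`; but `k` lies in
`h⁻`. -/
theorem not_precedes_minus_minus (hX : IsCAT0 X) {h k : Curtain X} {z : X}
    (hd : Disjoint h.carrier k.carrier) (zh : z ∈ h.plus) (zk : z ∈ k.plus)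
    (h1 : k.carrier ⊆ h.minus) (h2 : h.carrier ⊆ k.minus) : False := by
  have hS : Disjoint (k.plus ∪ k.carrier) h.carrier := by
    refine disjoint_union_left.2 ⟨?_, hd.symm⟩
    exact ((k.disjoint_minus_plus hX).mono_left h2).symm
  have := h.subset_plus_of_disjoint hX (k.isPreconnected_plus_union hX) hS (.inl zk) zh
  obtain ⟨w, hw⟩ := k.nonempty_carrier hX
  exact disjoint_left.1 (h.disjoint_minus_plus hX) (h1 hw) (this (.inr hw))

/-- Disjoint curtains that both separate `x` from `z` are comparable. -/
theorem precedes_total (hX : IsCAT0 X) {h k : Curtain X} {x z : X}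
    (hd : Disjoint h.carrier k.carrier) (xh : x ∈ h.minus) (xk : x ∈ k.minus) (zh : z ∈ h.plus)
    (zk : z ∈ k.plus) : h.Precedes k ∨ k.Precedes h := by
  rcases h.subset_minus_or_subset_plus hX (k.isPreconnected_carrier hX) hd.symm with h1 | h1 <;>
  rcases k.subset_minus_or_subset_plus hX (h.isPreconnected_carrier hX) hd with h2 | h2
  · exact (not_precedes_minus_minus hX hd zh zk h1 h2).elim
  · exact .inr ⟨h1, h2⟩
  · exact .inl ⟨h2, h1⟩
  -- Reversing both curtains turns the case of two positive half spaces into the excluded one, with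
  -- `x` in the role of `z`.
  · refine (not_precedes_minus_minus hX (h := h.flip) (k := k.flip) (z := x) ?_ ?_ ?_ ?_ ?_).elim <;>
      simpa only [flip_carrier, flip_minus, flip_plus]

/-- A segment from `x` to a point of `k` crosses the middle of `h`, and still has to travel at least
`1 / 2` to leave `h`. Thus distance from `x` is a numerical key that sorts separating families. -/
theorem Precedes.infDist_lt (hX : IsCAT0 X) {h k : Curtain X} {x : X} (hk : h.Precedes k)
    (xh : x ∈ h.minus) : Metric.infDist x h.carrier < Metric.infDist x k.carrier := by
  suffices Metric.infDist x h.carrier + 1 / 2 ≤ Metric.infDist x k.carrier by linarith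
  refine (Metric.le_infDist (k.nonempty_carrier hX)).2 fun {q} hq => ?_
  obtain ⟨S, hS, xS, qS, hb⟩ := hX.exists_isPreconnected x q
  have xh' := (h.mem_minus hX).1 xh
  have qh := (h.mem_plus hX).1 (hk.2 hq)
  obtain ⟨w, hw, hw'⟩ := hS.intermediate_value xS qS
    (h.lipschitz_height hX).continuous.continuousOn
    (show (0 : ℝ) ∈ Icc _ _ by constructor <;> linarith)
  have h1 : Metric.infDist x h.carrier ≤ dist x w :=
    Metric.infDist_le_dist_of_mem ((h.mem_carrier hX).2 (by rw [hw']; norm_num))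
  have h2 := h.abs_height_sub_le hX q w
  rw [hw', sub_zero] at h2
  have h3 := le_abs_self (h.height q)
  have h4 := hb w hw
  rw [dist_comm w q] at h4
  linarith

end Curtain

/-- A finite family of pairwise disjoint curtains, all with `x` in `h⁻` and `z` in `h⁺`. -/
structure SeparatingFamily (x z : X) (S : Finset (Curtain X)) : Prop where
  disjoint : ∀ h ∈ S, ∀ k ∈ S, h ≠ k → Disjoint h.carrier k.carrier
  left : ∀ h ∈ S, x ∈ h.minus
  right : ∀ h ∈ S, z ∈ h.plus

namespace SeparatingFamily

variable {x z : X} {S : Finset (Curtain X)}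

theorem mono (hS : SeparatingFamily x z S) {T : Finset (Curtain X)} (h : T ⊆ S) :
    SeparatingFamily x z T :=
  ⟨fun a ha b hb => hS.disjoint a (h ha) b (h hb), fun a ha => hS.left a (h ha),
    fun a ha => hS.right a (h ha)⟩

theorem exists_first (hX : IsCAT0 X) (hS : SeparatingFamily x z S) (hne : S.Nonempty) :
    ∃ h ∈ S, ∀ k ∈ S, k ≠ h → h.Precedes k := by
  obtain ⟨h, hh, hmin⟩ := S.exists_min_image (fun h => Metric.infDist x h.carrier) hne
  refine ⟨h, hh, fun k hk hkh => ?_⟩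
  refine (Curtain.precedes_total hX (hS.disjoint h hh k hk hkh.symm) (hS.left h hh) (hS.left k hk)
    (hS.right h hh) (hS.right k hk)).resolve_right fun h1 => ?_
  exact absurd (h1.infDist_lt hX (hS.left k hk)) (not_lt.2 (hmin k hk))

theorem exists_sorted (hX : IsCAT0 X) (hS : SeparatingFamily x z S) :
    ∃ c : Fin S.card → Curtain X, Function.Injective c ∧ (∀ i, c i ∈ S) ∧
      ∀ i j, i < j → (c i).Precedes (c j) := by
  let e := S.equivFin.symm
  let key : Fin S.card → ℝ := fun i => Metric.infDist x (e i).1.carrier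
  let σ := Tuple.sort key
  have hmono : Monotone (key ∘ σ) := Tuple.monotone_sort key
  have hinj : Function.Injective fun i => (e (σ i)).1 :=
    Subtype.val_injective.comp (e.injective.comp σ.injective)
  refine ⟨fun i => (e (σ i)).1, hinj, fun i => (e (σ i)).2, fun i j hij => ?_⟩
  have hi := (e (σ i)).2
  have hj := (e (σ j)).2
  refine (Curtain.precedes_total hX (hS.disjoint _ hi _ hj (hinj.ne hij.ne)) (hS.left _ hi)
    (hS.left _ hj) (hS.right _ hi) (hS.right _ hj)).resolve_right fun h1 => ?_
  exact absurd (h1.infDist_lt hX (hS.left _ hj)) (not_lt.2 (hmono hij.le))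

theorem exists_chain (hX : IsCAT0 X) (hS : SeparatingFamily x z S) :
    ∃ c : Fin S.card → Curtain X, Function.Injective c ∧ (∀ i, c i ∈ S) ∧ IsCurtainChain c := by
  obtain ⟨c, hinj, hmem, hc⟩ := hS.exists_sorted hX
  refine ⟨c, hinj, hmem, fun i j hij => hS.disjoint _ (hmem i) _ (hmem j) (hinj.ne hij), ?_⟩
  intro i j k hij hjk
  exact .inl ⟨(hc i j (Fin.lt_def.2 (by omega))).1, (hc j k (Fin.lt_def.2 (by omega))).2⟩

theorem card_le_of_lSeparated (hX : IsCAT0 X) (hS : SeparatingFamily x z S) {L : ℕ}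
    {k l : Curtain X} (hkl : LSeparated L k l)
    (h : ∀ a ∈ S, (a.carrier ∩ k.carrier).Nonempty ∧ (a.carrier ∩ l.carrier).Nonempty) :
    S.card ≤ L := by
  obtain ⟨c, -, hmem, hc⟩ := hS.exists_chain hX
  exact hkl.2 _ c hc fun i => h _ (hmem i)

-- Along a geodesic from `x` to `z` the height of each curtain is 1-Lipschitz and takes all values
-- in an interval of length 1, so the parameters inside that curtain have measure at least 1.
-- Disjoint curtains occupy disjoint parameter sets.
open MeasureTheory in
theorem card_le_dist (hX : IsCAT0 X) (hS : SeparatingFamily x z S) : (S.card : ℝ) ≤ dist x z := by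
  obtain ⟨α, hα, h0, h1⟩ := hX.exists_isGeodesicOn x z
  let A : Curtain X → Set ℝ := fun h => Icc 0 (dist x z) ∩ {s | α s ∈ h.carrier}
  have hcont : ∀ h : Curtain X, ContinuousOn (fun s => h.height (α s)) (Icc 0 (dist x z)) :=
    fun h => (h.lipschitz_height hX).continuous.comp_continuousOn hα.continuousOn
  have hA : ∀ h, A h = Icc 0 (dist x z) ∩ (fun s => h.height (α s)) ⁻¹' Icc (-(1 / 2)) (1 / 2) := by
    intro h
    ext s
    simp only [A, mem_inter_iff, mem_ofPred_eq, h.mem_carrier hX, mem_preimage]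
  have hmeas : ∀ h ∈ S, MeasurableSet (A h) := fun h _ => by
    rw [hA]
    exact ((hcont h).preimage_isClosed_of_isClosed isClosed_Icc isClosed_Icc).measurableSet
  have hdisj : (S : Set (Curtain X)).PairwiseDisjoint A := fun h hh k hk hne =>
    disjoint_left.2 fun s hs ht => disjoint_left.1 (hS.disjoint h hh k hk hne) hs.2 ht.2
  have hvol : ∀ h ∈ S, 1 ≤ volume (A h) := by
    intro h hh
    have hl : LipschitzOnWith 1 (fun s => h.height (α s)) (A h) := by
      refine LipschitzOnWith.of_dist_le_mul fun s hs t ht => ?_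
      have := h.abs_height_sub_le hX (α s) (α t)
      rw [hα.isometric s hs.1 t ht.1] at this
      simpa [Real.dist_eq] using this
    have hle := hl.hausdorffMeasure_image_le (d := 1) zero_le_one
    rw [hausdorffMeasure_real] at hle
    have hsub : Icc (-(1 / 2) : ℝ) (1 / 2) ⊆ (fun s => h.height (α s)) '' A h := by
      intro t ht
      have hx := (h.mem_minus hX).1 (hS.left h hh)
      have hz := (h.mem_plus hX).1 (hS.right h hh)
      obtain ⟨s, hs, rfl⟩ := intermediate_value_Icc dist_nonneg (hcont h)
        (show t ∈ Icc (h.height (α 0)) (h.height (α (dist x z))) by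
          rw [h0, h1]; exact ⟨by linarith [ht.1], by linarith [ht.2]⟩)
      exact ⟨s, by rw [hA]; exact ⟨hs, ht⟩, rfl⟩
    calc (1 : ℝ≥0∞) = volume (Icc (-(1 / 2) : ℝ) (1 / 2)) := by rw [Real.volume_Icc]; norm_num
      _ ≤ _ := measure_mono hsub
      _ ≤ _ := hle
      _ = _ := by simp
  have hsum : (S.card : ℝ≥0∞) ≤ ENNReal.ofReal (dist x z) := by
    calc (S.card : ℝ≥0∞) = ∑ h ∈ S, 1 := by simp
      _ ≤ ∑ h ∈ S, volume (A h) := Finset.sum_le_sum hvol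
      _ = volume (⋃ h ∈ S, A h) := (measure_biUnion_finset hdisj hmeas).symm
      _ ≤ volume (Icc 0 (dist x z)) :=
        measure_mono (iUnion₂_subset fun h _ => inter_subset_left)
      _ = _ := by rw [Real.volume_Icc, sub_zero]
  have := ENNReal.toReal_mono ENNReal.ofReal_ne_top hsum
  rwa [ENNReal.toReal_natCast, ENNReal.toReal_ofReal dist_nonneg] at this

end SeparatingFamily

end Curtains

/-! ### Chains, `L`-separated families and the metrics `dL` -/

section Chains

variable {X : Type*} [MetricSpace X]

theorem Curtain.Precedes.disjoint (hX : IsCAT0 X) {h k : Curtain X} (hk : h.Precedes k) :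
    Disjoint h.carrier k.carrier :=
  (k.disjoint_minus_carrier hX).mono_left hk.1

theorem isCurtainChain_of_precedes (hX : IsCAT0 X) {n : ℕ} {c : Fin n → Curtain X}
    (hc : ∀ i j, i < j → (c i).Precedes (c j)) : IsCurtainChain c := by
  refine ⟨fun i j hij => ?_, fun i j k hij hjk => .inl
    ⟨(hc i j (Fin.lt_def.2 (by omega))).1, (hc j k (Fin.lt_def.2 (by omega))).2⟩⟩
  rcases lt_or_gt_of_ne hij with h | h
  · exact (hc i j h).disjoint hX
  · exact ((hc j i h).disjoint hX).symm

theorem Curtain.precedes_of_dual (hX : IsCAT0 X) {h k : Curtain X} (hI : h.I = k.I)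
    (hγ : h.γ = k.γ) (hr : h.r + 1 < k.r) : h.Precedes k := by
  have e : ∀ x, h.height x = k.height x + k.r - h.r := fun x => by
    simp only [Curtain.height, hI, hγ]; ring
  constructor
  · intro x hx
    rw [h.mem_carrier hX, e] at hx
    rw [k.mem_minus hX]
    linarith [hx.2]
  · intro x hx
    rw [k.mem_carrier hX] at hx
    rw [h.mem_plus hX, e]
    linarith [hx.1]

variable {I : Set ℝ} {γ : ℝ → X}

namespace IsGeodesicOn

/-- The curtain dual to a geodesic at `r`. -/
def dual (hg : IsGeodesicOn I γ) (r : ℝ) (hr : Icc (r - 1 / 2) (r + 1 / 2) ⊆ interior I) :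
    Curtain X :=
  ⟨I, γ, r, hg.isClosed, hg.ordConnected, hg.isometric, hr⟩

theorem reverse (hg : IsGeodesicOn I γ) : IsGeodesicOn (Neg.neg ⁻¹' I) fun t => γ (-t) where
  isClosed := hg.isClosed.preimage continuous_neg
  ordConnected := ⟨fun _ ha _ hb _ hc =>
    hg.ordConnected.out hb ha ⟨neg_le_neg hc.2, neg_le_neg hc.1⟩⟩
  nonempty := by
    obtain ⟨t, ht⟩ := hg.nonempty
    exact ⟨-t, by simpa using ht⟩
  isometric s hs t ht := by
    rw [hg.isometric _ hs _ ht, ← abs_neg]; ring_nf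

theorem isPreconnected_image (hg : IsGeodesicOn I γ) {s t : ℝ} (hs : s ∈ I) (ht : t ∈ I) :
    IsPreconnected (γ '' Icc s t) :=
  isPreconnected_Icc.image _ (hg.continuousOn.mono (hg.ordConnected.out hs ht))

/-- A chain of `n` curtains dual to a geodesic between `γ s` and `γ t`, each of which meets every
connected set with a point before `γ s` and a point after `γ t`. -/
theorem exists_dual_chain (hX : IsCAT0 X) (hg : IsGeodesicOn I γ) {s t : ℝ} (hs : s ∈ I)
    (ht : t ∈ I) {n : ℕ} (hn : s + 2 * n ≤ t) :
    ∃ c : Fin n → Curtain X, IsCurtainChain c ∧ ∀ i, ∀ S : Set X, IsPreconnected S →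
      ∀ a ∈ I, ∀ b ∈ I, a ≤ s → t ≤ b → γ a ∈ S → γ b ∈ S → ((c i).carrier ∩ S).Nonempty := by
  have hpole : ∀ i : Fin n, Icc (s + 1 + 2 * (i : ℝ) - 1 / 2) (s + 1 + 2 * (i : ℝ) + 1 / 2) ⊆
      Ioo s t := by
    intro i u hu
    have h0 : (0 : ℝ) ≤ i := Nat.cast_nonneg _
    have h1 : (i : ℝ) + 1 ≤ n := by exact_mod_cast i.2
    constructor
    · linarith [hu.1]
    · linarith [hu.2]
  have hint : Ioo s t ⊆ interior I :=
    interior_maximal (Ioo_subset_Icc_self.trans (hg.ordConnected.out hs ht)) isOpen_Ioo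
  -- Spacing 2 keeps consecutive poles of length 1 strictly apart, since curtains are closed and may
  -- not touch.
  refine ⟨fun i => hg.dual (s + 1 + 2 * i) ((hpole i).trans hint), ?_, ?_⟩
  · refine isCurtainChain_of_precedes hX fun i j hij => Curtain.precedes_of_dual hX rfl rfl ?_
    have : (i : ℝ) + 1 ≤ j := by exact_mod_cast hij
    change s + 1 + 2 * (i : ℝ) + 1 < s + 1 + 2 * (j : ℝ)
    linarith
  · intro i S hS a ha b hb has htb haS hbS
    rw [inter_comm]
    have hp := hpole i (left_mem_Icc.2 (by linarith))
    have hq := hpole i (right_mem_Icc.2 (by linarith))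
    refine Curtain.inter_nonempty hX _ hS haS hbS ?_ ?_
    · rw [Curtain.mem_plus hX, Curtain.height]
      change ¬ (_ < foot I γ (γ a) - (s + 1 + 2 * (i : ℝ)))
      rw [hg.foot_apply hX ha]
      linarith [hp.1]
    · rw [Curtain.mem_minus hX, Curtain.height]
      change ¬ (foot I γ (γ b) - (s + 1 + 2 * (i : ℝ)) < _)
      rw [hg.foot_apply hX hb]
      linarith [hq.2]

end IsGeodesicOn

theorem LSeparated.symm {L : ℕ} {h k : Curtain X} (hk : LSeparated L h k) : LSeparated L k h :=
  ⟨hk.1.symm, fun n c hc hm => hk.2 n c hc fun i => (hm i).symm⟩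

theorem LSeparated.congr {L : ℕ} {h k h' k' : Curtain X} (hk : LSeparated L h k)
    (e : h'.carrier = h.carrier) (e' : k'.carrier = k.carrier) : LSeparated L h' k' := by
  simpa only [LSeparated, e, e'] using hk

/-- A finite family of pairwise `L`-separated curtains with `x` in `h⁻` and `z` in `h⁺`. -/
structure LFamily (L : ℕ) (x z : X) (S : Finset (Curtain X)) : Prop
    extends SeparatingFamily x z S where
  separated : ∀ h ∈ S, ∀ k ∈ S, h ≠ k → LSeparated L h k

namespace LFamily

variable {L : ℕ} {x y z : X} {S : Finset (Curtain X)}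

theorem mono (hS : LFamily L x z S) {T : Finset (Curtain X)} (h : T ⊆ S) : LFamily L x z T :=
  ⟨hS.toSeparatingFamily.mono h, fun a ha b hb => hS.separated a (h ha) b (h hb)⟩

theorem exists_lChain (hX : IsCAT0 X) (hS : LFamily L x z S) :
    ∃ c : Fin S.card → Curtain X, IsLChain L c ∧ ∀ i, (c i).Separates {x} {z} := by
  obtain ⟨c, hinj, hmem, hc⟩ := hS.toSeparatingFamily.exists_chain hX
  refine ⟨c, ⟨hc, fun i j hij => hS.separated _ (hmem i) _ (hmem j) (hinj.ne hij)⟩, fun i => ?_⟩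
  exact .inl ⟨singleton_subset_iff.2 (hS.left _ (hmem i)),
    singleton_subset_iff.2 (hS.right _ (hmem i))⟩

-- Separation leaves the orientation of each curtain open; flipping fixes it without changing
-- carriers, so disjointness and `L`-separation survive. Disjointness of non-empty carriers makes
-- the oriented curtains distinct.
open Classical in
theorem of_lChain (hX : IsCAT0 X) {n : ℕ} {c : Fin n → Curtain X} (hc : IsLChain L c)
    (hs : ∀ i, (c i).Separates {x} {z}) : ∃ S, LFamily L x z S ∧ S.card = n := by
  have ho : ∀ i, ∃ h : Curtain X, h.carrier = (c i).carrier ∧ x ∈ h.minus ∧ z ∈ h.plus := by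
    intro i
    rcases hs i with ⟨h1, h2⟩ | ⟨h1, h2⟩
    · exact ⟨c i, rfl, singleton_subset_iff.1 h1, singleton_subset_iff.1 h2⟩
    · exact ⟨(c i).flip, (c i).flip_carrier, by rw [Curtain.flip_minus]; simpa using h1,
        by rw [Curtain.flip_plus]; simpa using h2⟩
  choose o ho hx hz using ho
  have hdisj : ∀ i j, i ≠ j → Disjoint (o i).carrier (o j).carrier := fun i j hij => by
    rw [ho, ho]; exact hc.1.1 i j hij
  have hinj : Function.Injective o := fun i j hij => by
    by_contra hne
    obtain ⟨w, hw⟩ := (o i).nonempty_carrier hX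
    exact disjoint_left.1 (hdisj i j hne) hw (hij ▸ hw)
  refine ⟨Finset.univ.image o, ⟨⟨?_, ?_, ?_⟩, ?_⟩, ?_⟩
  · simp only [Finset.mem_image, Finset.mem_univ, true_and]
    rintro _ ⟨i, rfl⟩ _ ⟨j, rfl⟩ hne
    exact hdisj i j fun e => hne (congrArg o e)
  · simp only [Finset.mem_image, Finset.mem_univ, true_and]
    rintro _ ⟨i, rfl⟩
    exact hx i
  · simp only [Finset.mem_image, Finset.mem_univ, true_and]
    rintro _ ⟨i, rfl⟩
    exact hz i
  · simp only [Finset.mem_image, Finset.mem_univ, true_and]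
    rintro _ ⟨i, rfl⟩ _ ⟨j, rfl⟩ hne
    exact (hc.2 i j fun e => hne (congrArg o e)).congr (ho i) (ho j)
  · rw [Finset.card_image_of_injective _ hinj, Finset.card_univ, Fintype.card_fin]

open Classical in
theorem flip (hS : LFamily L x z S) : LFamily L z x (S.image Curtain.flip) := by
  refine ⟨⟨?_, ?_, ?_⟩, ?_⟩ <;> simp only [Finset.mem_image]
  · rintro _ ⟨h, hh, rfl⟩ _ ⟨k, hk, rfl⟩ hne
    rw [Curtain.flip_carrier, Curtain.flip_carrier]
    exact hS.disjoint h hh k hk fun e => hne (congrArg _ e)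
  · rintro _ ⟨h, hh, rfl⟩
    rw [Curtain.flip_minus]
    exact hS.right h hh
  · rintro _ ⟨h, hh, rfl⟩
    rw [Curtain.flip_plus]
    exact hS.left h hh
  · rintro _ ⟨h, hh, rfl⟩ _ ⟨k, hk, rfl⟩ hne
    exact (hS.separated h hh k hk fun e => hne (congrArg _ e)).congr h.flip_carrier k.flip_carrier

end LFamily

variable {L : ℕ} {x y z : X}

theorem dL_self (L : ℕ) (x : X) : dL L x x = 0 := by simp [dL]

theorem exists_dL (hX : IsCAT0 X) (L : ℕ) {x z : X} (hne : x ≠ z) :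
    ∃ S, LFamily L x z S ∧ dL L x z = 1 + S.card ∧ ∀ T, LFamily L x z T → T.card ≤ S.card := by
  set A := {n : ℕ | ∃ c : Fin n → Curtain X, IsLChain L c ∧ ∀ i, (c i).Separates {x} {z}} with hA
  have hne' : A.Nonempty :=
    ⟨0, fun i => i.elim0, ⟨⟨fun i => i.elim0, fun i => i.elim0⟩, fun i => i.elim0⟩,
      fun i => i.elim0⟩
  -- On `ℕ` the supremum of an unbounded set is `0` by default; the bound makes `sSup` an attained
  -- maximum.
  have hbdd : BddAbove A := by
    refine ⟨⌊dist x z⌋₊, ?_⟩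
    rintro n ⟨c, hc, hs⟩
    obtain ⟨S, hS, rfl⟩ := LFamily.of_lChain hX hc hs
    exact Nat.le_floor (hS.card_le_dist hX)
  obtain ⟨c, hc, hs⟩ := Nat.sSup_mem hne' hbdd
  obtain ⟨S, hS, hcard⟩ := LFamily.of_lChain hX hc hs
  refine ⟨S, hS, ?_, fun T hT => ?_⟩
  · rw [dL, if_neg hne, hcard]
  · rw [hcard]
    exact le_csSup hbdd (hT.exists_lChain hX)

theorem LFamily.card_lt_dL (hX : IsCAT0 X) {S : Finset (Curtain X)} (hS : LFamily L x z S)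
    (hne : x ≠ z) : 1 + (S.card : ℝ) ≤ dL L x z := by
  obtain ⟨T, -, hd, hmax⟩ := exists_dL hX L hne
  rw [hd]
  have := hmax S hS
  gcongr

theorem dL_nonneg (L : ℕ) (x z : X) : 0 ≤ dL L x z := by
  rw [dL]; split_ifs <;> positivity

theorem dL_le (hX : IsCAT0 X) (L : ℕ) (x z : X) : dL L x z ≤ 1 + dist x z := by
  rcases eq_or_ne x z with rfl | hne
  · rw [dL_self]; simp
  · obtain ⟨T, hT, hd, -⟩ := exists_dL hX L hne
    rw [hd]
    linarith [hT.card_le_dist hX]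

-- Sort a maximal family by the position of `y`. At most one curtain contains `y`, and the summand 1
-- in `dL`, counted twice on the right, pays for it.
open Classical in
theorem dL_triangle (hX : IsCAT0 X) (L : ℕ) (x y z : X) : dL L x z ≤ dL L x y + dL L y z := by
  rcases eq_or_ne x y with rfl | hxy
  · simp [dL_self]
  rcases eq_or_ne y z with rfl | hyz
  · simp [dL_self]
  rcases eq_or_ne x z with rfl | hxz
  · rw [dL_self]; exact add_nonneg (dL_nonneg _ _ _) (dL_nonneg _ _ _)
  obtain ⟨S, hS, hd, -⟩ := exists_dL hX L hxz
  have h1 : LFamily L x y (S.filter fun h => y ∈ h.plus) := by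
    have := hS.mono (Finset.filter_subset (fun h => y ∈ h.plus) S)
    exact ⟨⟨this.disjoint, this.left, fun h hh => (Finset.mem_filter.1 hh).2⟩, this.separated⟩
  have h2 : LFamily L y z (S.filter fun h => y ∈ h.minus) := by
    have := hS.mono (Finset.filter_subset (fun h => y ∈ h.minus) S)
    exact ⟨⟨this.disjoint, fun h hh => (Finset.mem_filter.1 hh).2, this.right⟩, this.separated⟩
  have h3 : (S.filter fun h => y ∈ h.carrier).card ≤ 1 := by
    refine Finset.card_le_one.2 fun h hh k hk => ?_
    rw [Finset.mem_filter] at hh hk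
    by_contra hne
    exact disjoint_left.1 (hS.disjoint h hh.1 k hk.1 hne) hh.2 hk.2
  have h4 : S ⊆ (S.filter fun h => y ∈ h.plus) ∪ (S.filter fun h => y ∈ h.minus) ∪
      (S.filter fun h => y ∈ h.carrier) := by
    intro h hh
    simp only [Finset.mem_union, Finset.mem_filter, hh, true_and]
    rcases h.mem_cases hX y with h | h | h <;> simp [h]
  have h5 := (Finset.card_le_card h4).trans
    ((Finset.card_union_le _ _).trans (Nat.add_le_add_right (Finset.card_union_le _ _) _))
  have h6 := h1.card_lt_dL hX hxy
  have h7 := h2.card_lt_dL hX hyz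
  have h8 : (S.card : ℝ) ≤ (S.filter fun h => y ∈ h.plus).card +
      (S.filter fun h => y ∈ h.minus).card + 1 := by
    exact_mod_cast h5.trans (Nat.add_le_add_left h3 _)
  rw [hd]
  linarith

open Classical in
/-- In an `L`-family separating `γ p` from `γ q`, few curtains meet the geodesic again between
`γ q` and `γ r`. -/
theorem LFamily.card_returning_le (hX : IsCAT0 X) (hg : IsGeodesicOn I γ) {p q r : ℝ} (hp : p ∈ I)
    (hr : r ∈ I) (hpq : p ≤ q) (hqr : q ≤ r) {S : Finset (Curtain X)}
    (hS : LFamily L (γ p) (γ q) S) (hret : ∀ h ∈ S, (γ '' Icc q r ∩ h.carrier).Nonempty) :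
    S.card ≤ 2 * L + 4 := by
  have hq : q ∈ I := hg.ordConnected.out hp hr ⟨hpq, hqr⟩
  rcases S.eq_empty_or_nonempty with rfl | hne
  · simp
  obtain ⟨h₁, hh₁, hfirst⟩ := hS.exists_first hX hne
  rcases (S.erase h₁).eq_empty_or_nonempty with he | hne'
  · have := Finset.card_erase_of_mem hh₁
    rw [he, Finset.card_empty] at this
    omega
  obtain ⟨h₂, hh₂, hsecond⟩ :=
    (hS.mono (Finset.erase_subset h₁ S)).exists_first hX hne'
  have hh₂S := Finset.mem_of_mem_erase hh₂
  have h12 := hfirst h₂ hh₂S (Finset.ne_of_mem_erase hh₂)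
  -- The first two curtains `h₁`, `h₂` both reach from before `γ s` to beyond `γ q`. Every other
  -- member separates `γ s` from `γ q`, so there are at most `q - s` of them.
  obtain ⟨_, ⟨s, hs, rfl⟩, hs2⟩ := h₂.inter_nonempty hX (hg.isPreconnected_image hp hq)
    (mem_image_of_mem γ (left_mem_Icc.2 hpq)) (mem_image_of_mem γ (right_mem_Icc.2 hpq))
    ((h₂.disjoint_minus_plus hX).notMem_of_mem_left (hS.left _ hh₂S))
    ((h₂.disjoint_minus_plus hX).notMem_of_mem_right (hS.right _ hh₂S))
  have hsI : s ∈ I := hg.ordConnected.out hp hq hs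
  obtain ⟨_, ⟨s', hs', rfl⟩, hs1⟩ := h₁.inter_nonempty hX (hg.isPreconnected_image hp hsI)
    (mem_image_of_mem γ (left_mem_Icc.2 hs.1)) (mem_image_of_mem γ (right_mem_Icc.2 hs.1))
    ((h₁.disjoint_minus_plus hX).notMem_of_mem_left (hS.left _ hh₁))
    ((h₁.disjoint_minus_plus hX).notMem_of_mem_right (h12.2 hs2))
  obtain ⟨_, ⟨t₁, ht₁, rfl⟩, htm₁⟩ := hret h₁ hh₁
  obtain ⟨_, ⟨t₂, ht₂, rfl⟩, htm₂⟩ := hret h₂ hh₂S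
  have hR : SeparatingFamily (γ s) (γ q) ((S.erase h₁).erase h₂) := by
    have hm := (hS.mono (Finset.erase_subset h₁ S)).mono (Finset.erase_subset h₂ _)
    refine ⟨hm.disjoint, fun h hh => ?_, hm.right⟩
    exact (hsecond h (Finset.mem_of_mem_erase hh) (Finset.ne_of_mem_erase hh)).1 hs2
  have hcard := hR.card_le_dist hX
  rw [hg.isometric s hsI q hq, abs_sub_comm, abs_of_nonneg (by linarith [hs.2]),
    Finset.card_erase_of_mem hh₂, Finset.card_erase_of_mem hh₁] at hcard
  have hfl : s + 2 * (⌊(q - s) / 2⌋₊ : ℝ) ≤ q := by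
    have := Nat.floor_le (a := (q - s) / 2) (by linarith [hs.2])
    linarith
  -- Roughly `(q - s) / 2` curtains dual to the segment itself are crossed by both `h₁` and `h₂`, so
  -- `L`-separation bounds `q - s` by `2 * L + 2`.
  obtain ⟨c, hc, hmeet⟩ := hg.exists_dual_chain hX hsI hq hfl
  have hL := (hS.separated h₁ hh₁ h₂ hh₂S (Finset.ne_of_mem_erase hh₂).symm).2 _ c hc fun i =>
    ⟨hmeet i _ (h₁.isPreconnected_carrier hX) s' (hg.ordConnected.out hp hsI hs') t₁
      (hg.ordConnected.out hq hr ht₁) hs'.2 ht₁.1 hs1 htm₁,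
    hmeet i _ (h₂.isPreconnected_carrier hX) s hsI t₂
      (hg.ordConnected.out hq hr ht₂) le_rfl ht₂.1 hs2 htm₂⟩
  have hlt := Nat.lt_floor_add_one ((q - s) / 2)
  have hL' : (⌊(q - s) / 2⌋₊ : ℝ) ≤ L := by exact_mod_cast hL
  have hfin : ((S.card - 1 - 1 : ℕ) : ℝ) < (2 * L + 2 : ℕ) := by push_cast; linarith
  have := Nat.cast_lt.1 hfin
  omega

open Classical in
theorem LFamily.card_returning_le' (hX : IsCAT0 X) (hg : IsGeodesicOn I γ) {p q r : ℝ} (hp : p ∈ I)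
    (hr : r ∈ I) (hpq : p ≤ q) (hqr : q ≤ r) {S : Finset (Curtain X)}
    (hS : LFamily L (γ q) (γ r) S) (hret : ∀ h ∈ S, (γ '' Icc p q ∩ h.carrier).Nonempty) :
    S.card ≤ 2 * L + 4 := by
  have hinj : Function.Injective (Curtain.flip (X := X)) :=
    Function.LeftInverse.injective Curtain.flip_flip
  rw [← Finset.card_image_of_injective S hinj]
  refine LFamily.card_returning_le hX hg.reverse (p := -r) (q := -q) (r := -p)
    (by simpa using hr) (by simpa using hp) (by linarith) (by linarith) ?_ ?_
  · simpa using hS.flip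
  · simp only [Finset.mem_image]
    rintro _ ⟨h, hh, rfl⟩
    rw [Curtain.flip_carrier]
    obtain ⟨_, ⟨t, ht, rfl⟩, hm⟩ := hret h hh
    exact ⟨γ t, ⟨-t, ⟨by linarith [ht.2], by linarith [ht.1]⟩, by simp⟩, hm⟩

end Chains

/-! ### Coarse additivity along geodesics -/

section Additivity

variable {X : Type*} [MetricSpace X] {I : Set ℝ} {γ : ℝ → X} {L : ℕ}

open Classical in
/-- `L`-families over consecutive segments of a geodesic can be merged at linear cost in `L`. -/
theorem LFamily.exists_merge (hX : IsCAT0 X) (hg : IsGeodesicOn I γ) {p q r : ℝ} (hp : p ∈ I)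
    (hr : r ∈ I) (hpq : p ≤ q) (hqr : q ≤ r) {S T : Finset (Curtain X)}
    (hS : LFamily L (γ p) (γ q) S) (hT : LFamily L (γ q) (γ r) T) :
    ∃ U, LFamily L (γ p) (γ r) U ∧ S.card + T.card ≤ U.card + (5 * L + 10) := by
  have hq : q ∈ I := hg.ordConnected.out hp hr ⟨hpq, hqr⟩
  set S₁ := S.filter fun h => ¬ (γ '' Icc q r ∩ h.carrier).Nonempty with hS₁def
  set T₁ := T.filter fun h => ¬ (γ '' Icc p q ∩ h.carrier).Nonempty with hT₁def
  have hScard : S.card ≤ S₁.card + (2 * L + 4) := by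
    have h1 : (S.filter fun h => (γ '' Icc q r ∩ h.carrier).Nonempty).card + S₁.card =
        S.card := by
      convert Finset.card_filter_add_card_filter_not (s := S)
        (fun h => (γ '' Icc q r ∩ h.carrier).Nonempty)
    have h2 := (hS.mono (Finset.filter_subset (fun h => (γ '' Icc q r ∩ h.carrier).Nonempty)
      S)).card_returning_le hX hg hp hr hpq hqr fun h hh => (Finset.mem_filter.1 hh).2
    omega
  have hTcard : T.card ≤ T₁.card + (2 * L + 4) := by
    have h1 : (T.filter fun h => (γ '' Icc p q ∩ h.carrier).Nonempty).card + T₁.card =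
        T.card := by
      convert Finset.card_filter_add_card_filter_not (s := T)
        (fun h => (γ '' Icc p q ∩ h.carrier).Nonempty)
    have h2 := (hT.mono (Finset.filter_subset (fun h => (γ '' Icc p q ∩ h.carrier).Nonempty)
      T)).card_returning_le' hX hg hp hr hpq hqr fun h hh => (Finset.mem_filter.1 hh).2
    omega
  have hSL : LFamily L (γ p) (γ q) S₁ := hS.mono (Finset.filter_subset _ _)
  have hTL : LFamily L (γ q) (γ r) T₁ := hT.mono (Finset.filter_subset _ _)
  have hSplus : ∀ h ∈ S₁, γ r ∈ h.plus := fun h hh =>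
    h.subset_plus_of_disjoint hX (hg.isPreconnected_image hq hr)
      (disjoint_iff_inter_eq_empty.2 (not_nonempty_iff_eq_empty.1 (Finset.mem_filter.1 hh).2))
      (mem_image_of_mem γ (left_mem_Icc.2 hqr)) (hSL.right h hh)
      (mem_image_of_mem γ (right_mem_Icc.2 hqr))
  have hTminus : ∀ k ∈ T₁, γ '' Icc p q ⊆ k.minus := fun k hk =>
    k.subset_minus_of_disjoint hX (hg.isPreconnected_image hp hq)
      (disjoint_iff_inter_eq_empty.2 (not_nonempty_iff_eq_empty.1 (Finset.mem_filter.1 hk).2))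
      (mem_image_of_mem γ (right_mem_Icc.2 hpq)) (hTL.left k hk)
  have hSmeet : ∀ h ∈ S₁, ∃ w ∈ h.carrier, ∀ k ∈ T₁, w ∈ k.minus := by
    intro h hh
    obtain ⟨w, hw, hw'⟩ := h.inter_nonempty hX (hg.isPreconnected_image hp hq)
      (mem_image_of_mem γ (left_mem_Icc.2 hpq)) (mem_image_of_mem γ (right_mem_Icc.2 hpq))
      ((h.disjoint_minus_plus hX).notMem_of_mem_left (hSL.left h hh))
      ((h.disjoint_minus_plus hX).notMem_of_mem_right (hSL.right h hh))
    exact ⟨w, hw', fun k hk => hTminus k hk hw⟩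
  have hSfam : LFamily L (γ p) (γ r) S₁ :=
    ⟨⟨hSL.disjoint, hSL.left, hSplus⟩, hSL.separated⟩
  have hTfam : LFamily L (γ p) (γ r) T₁ :=
    ⟨⟨hTL.disjoint, fun k hk => hTminus k hk (mem_image_of_mem γ (left_mem_Icc.2 hpq)),
      hTL.right⟩, hTL.separated⟩
  rcases T₁.eq_empty_or_nonempty with he | hne
  · refine ⟨S₁, hSfam, ?_⟩
    rw [he, Finset.card_empty] at hTcard
    omega
  obtain ⟨k₁, hk₁, hfirst⟩ := hTfam.exists_first hX hne
  have hcard₁ := Finset.card_erase_of_mem hk₁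
  rcases (T₁.erase k₁).eq_empty_or_nonempty with he | hne'
  · refine ⟨S₁, hSfam, ?_⟩
    rw [he, Finset.card_empty] at hcard₁
    omega
  obtain ⟨k₂, hk₂, hsecond⟩ := (hTfam.mono (Finset.erase_subset k₁ T₁)).exists_first hX hne'
  have hk₂T := Finset.mem_of_mem_erase hk₂
  have hcard₂ := Finset.card_erase_of_mem hk₂
  -- A member of `S₁` has a point on `γ '' Icc p q`, before all of `T₁`. If it meets anything in
  -- `T₁` beyond `k₁`, it meets both `k₁` and `k₂`, so `L`-separation allows at most `L` such
  -- members.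
  set P : Curtain X → Prop := fun h => ∃ k ∈ T₁.erase k₁, (h.carrier ∩ k.carrier).Nonempty
  have hB : (S₁.filter P).card ≤ L := by
    refine (hSfam.mono (Finset.filter_subset P S₁)).card_le_of_lSeparated hX
      (hTfam.separated k₁ hk₁ k₂ hk₂T (Finset.ne_of_mem_erase hk₂).symm) fun h hh => ?_
    obtain ⟨hh, k, hk, v, hvh, hvk⟩ := Finset.mem_filter.1 hh
    obtain ⟨w, hw, hwm⟩ := hSmeet h hh
    have meet : ∀ k' ∈ T₁, v ∈ k'.plus → (h.carrier ∩ k'.carrier).Nonempty := fun k' hk' hv =>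
      k'.inter_nonempty hX (h.isPreconnected_carrier hX) hw hvh
        ((k'.disjoint_minus_plus hX).notMem_of_mem_left (hwm k' hk'))
        ((k'.disjoint_minus_plus hX).notMem_of_mem_right hv)
    refine ⟨meet k₁ hk₁
      ((hfirst k (Finset.mem_of_mem_erase hk) (Finset.ne_of_mem_erase hk)).2 hvk), ?_⟩
    rcases eq_or_ne k k₂ with rfl | hne
    · exact ⟨v, hvh, hvk⟩
    · exact meet k₂ hk₂T ((hsecond k hk hne).2 hvk)
  have hBcard := Finset.card_filter_add_card_filter_not (s := S₁) P
  set S₂ := S₁.filter fun h => ¬ P h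
  set T₂ := (T₁.erase k₁).erase k₂
  have hS₂ : S₂ ⊆ S₁ := Finset.filter_subset _ _
  have hT₂' : T₂ ⊆ T₁.erase k₁ := Finset.erase_subset _ _
  have hT₂ : T₂ ⊆ T₁ := hT₂'.trans (Finset.erase_subset _ _)
  have hcross : ∀ h ∈ S₂, ∀ k ∈ T₁.erase k₁, Disjoint h.carrier k.carrier := fun h hh k hk => by
    by_contra hd
    exact (Finset.mem_filter.1 hh).2 ⟨k, hk, not_disjoint_iff_nonempty_inter.1 hd⟩
  -- Here `k₂` serves as a barrier: a curtain meeting `h` and `k` must cross `k₂`, which is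
  -- `L`-separated from `k`. The total loss is `2 * (2 * L + 4)` returning curtains, `L` crossing
  -- ones, and `k₁`, `k₂`.
  have hsep : ∀ h ∈ S₂, ∀ k ∈ T₂, LSeparated L h k := by
    intro h hh k hk
    refine ⟨hcross h hh k (hT₂' hk), fun n c hc hm => ?_⟩
    have hne2 : k ≠ k₂ := Finset.ne_of_mem_erase hk
    refine (hTfam.separated k₂ hk₂T k (hT₂ hk) hne2.symm).2 n c hc fun i => ⟨?_, (hm i).2⟩
    obtain ⟨⟨a, hac, hah⟩, b, hbc, hbk⟩ := hm i
    obtain ⟨w, hw, hwm⟩ := hSmeet h (hS₂ hh)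
    have ha : a ∈ k₂.minus := k₂.subset_minus_of_disjoint hX (h.isPreconnected_carrier hX)
      (hcross h hh k₂ hk₂) hw (hwm k₂ hk₂T) hah
    exact k₂.inter_nonempty hX ((c i).isPreconnected_carrier hX) hac hbc
      ((k₂.disjoint_minus_plus hX).notMem_of_mem_left ha)
      ((k₂.disjoint_minus_plus hX).notMem_of_mem_right ((hsecond k (hT₂' hk) hne2).2 hbk))
  have hdisj : Disjoint S₂ T₂ := by
    refine Finset.disjoint_left.2 fun h hh hk => ?_
    obtain ⟨w, hw⟩ := h.nonempty_carrier hX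
    exact disjoint_left.1 (hsep h hh h hk).1 hw hw
  have hUsep : ∀ h ∈ S₂ ∪ T₂, ∀ k ∈ S₂ ∪ T₂, h ≠ k → LSeparated L h k := by
    intro h hh k hk hne
    rcases Finset.mem_union.1 hh with hh | hh <;> rcases Finset.mem_union.1 hk with hk | hk
    · exact hSfam.separated h (hS₂ hh) k (hS₂ hk) hne
    · exact hsep h hh k hk
    · exact (hsep k hk h hh).symm
    · exact hTfam.separated h (hT₂ hh) k (hT₂ hk) hne
  refine ⟨S₂ ∪ T₂, ⟨⟨fun h hh k hk hne => (hUsep h hh k hk hne).1, ?_, ?_⟩, hUsep⟩, ?_⟩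
  · intro h hh
    rcases Finset.mem_union.1 hh with hh | hh
    · exact hSfam.left h (hS₂ hh)
    · exact hTfam.left h (hT₂ hh)
  · intro h hh
    rcases Finset.mem_union.1 hh with hh | hh
    · exact hSfam.right h (hS₂ hh)
    · exact hTfam.right h (hT₂ hh)
  · rw [Finset.card_union_of_disjoint hdisj]
    omega

/-- Up to an error linear in `L`, the metric `d_L` is additive along geodesics. -/
theorem dL_add_le (hX : IsCAT0 X) (hg : IsGeodesicOn I γ) (L : ℕ) {p q r : ℝ} (hp : p ∈ I)
    (hr : r ∈ I) (hpq : p ≤ q) (hqr : q ≤ r) :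
    dL L (γ p) (γ q) + dL L (γ q) (γ r) ≤ dL L (γ p) (γ r) + (5 * L + 11) := by
  have hq : q ∈ I := hg.ordConnected.out hp hr ⟨hpq, hqr⟩
  have hinj : ∀ s ∈ I, ∀ t ∈ I, s ≠ t → γ s ≠ γ t := fun s hs t ht hst h => by
    have := hg.isometric s hs t ht
    rw [h, dist_self, eq_comm, abs_eq_zero, sub_eq_zero] at this
    exact hst this
  rcases hpq.eq_or_lt with rfl | hpq'
  · rw [dL_self]; linarith [(Nat.cast_nonneg L : (0 : ℝ) ≤ L)]
  rcases hqr.eq_or_lt with rfl | hqr'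
  · rw [dL_self]; linarith [(Nat.cast_nonneg L : (0 : ℝ) ≤ L)]
  obtain ⟨S, hS, hSd, -⟩ := exists_dL hX L (hinj p hp q hq hpq'.ne)
  obtain ⟨T, hT, hTd, -⟩ := exists_dL hX L (hinj q hq r hr hqr'.ne)
  obtain ⟨U, hU, hcard⟩ := hS.exists_merge hX hg hp hr hpq hqr hT
  have h1 := hU.card_lt_dL hX (hinj p hp r hr (hpq'.trans hqr').ne)
  have h2 : (S.card : ℝ) + T.card ≤ U.card + (5 * L + 10) := by exact_mod_cast hcard
  rw [hSd, hTd]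
  linarith

theorem summable_dHat (hX : IsCAT0 X) (x y : X) :
    Summable fun k : ℕ => dL (k + 1) x y / ((k : ℝ) + 1) ^ 3 := by
  have h1 : Summable fun k : ℕ => (1 + dist x y) * (1 / ((k : ℝ) + 1) ^ 3) := by
    refine Summable.mul_left _ ?_
    have := (summable_nat_add_iff 1).2 (Real.summable_one_div_nat_pow.2 (by norm_num : 1 < 3))
    simpa using this
  refine Summable.of_nonneg_of_le (fun k => div_nonneg (dL_nonneg _ _ _) (by positivity))
    (fun k => ?_) h1
  rw [mul_one_div]
  gcongr
  exact dL_le hX _ x y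

theorem dL_div_le_dHat (hX : IsCAT0 X) (x y : X) {L : ℕ} (hL : 0 < L) :
    dL L x y / (L : ℝ) ^ 3 ≤ dHat x y := by
  obtain ⟨k, rfl⟩ := Nat.exists_eq_succ_of_ne_zero hL.ne'
  have := (summable_dHat hX x y).le_tsum k fun j _ => div_nonneg (dL_nonneg _ _ _) (by positivity)
  simpa [dHat] using this

theorem dHat_triangle (hX : IsCAT0 X) (x y z : X) : dHat x z ≤ dHat x y + dHat y z := by
  rw [dHat, dHat, dHat, ← (summable_dHat hX x y).tsum_add (summable_dHat hX y z)]
  refine (summable_dHat hX x z).tsum_le_tsum (fun k => ?_)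
    ((summable_dHat hX x y).add (summable_dHat hX y z))
  rw [← add_div]
  gcongr
  exact dL_triangle hX _ x y z

/-- Up to a universal constant, the metric of the curtain model is additive along geodesics. -/
theorem dHat_add_le (hX : IsCAT0 X) (hg : IsGeodesicOn I γ) {p q r : ℝ} (hp : p ∈ I)
    (hr : r ∈ I) (hpq : p ≤ q) (hqr : q ≤ r) :
    dHat (γ p) (γ q) + dHat (γ q) (γ r) ≤
      dHat (γ p) (γ r) + ∑' k : ℕ, 16 * (1 / ((k : ℝ) + 1) ^ 2) := by
  have hs : Summable fun k : ℕ => 16 * (1 / ((k : ℝ) + 1) ^ 2) := by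
    refine Summable.mul_left _ ?_
    have := (summable_nat_add_iff 1).2 (Real.summable_one_div_nat_pow.2 (by norm_num : 1 < 2))
    simpa using this
  have h1 := summable_dHat hX (γ p) (γ q)
  have h2 := summable_dHat hX (γ q) (γ r)
  have h3 := summable_dHat hX (γ p) (γ r)
  rw [dHat, dHat, dHat, ← h1.tsum_add h2, ← h3.tsum_add hs]
  refine (h1.add h2).tsum_le_tsum (fun k => ?_) (h3.add hs)
  have hk : (0 : ℝ) < (k : ℝ) + 1 := by positivity
  have key := dL_add_le hX hg (k + 1) hp hr hpq hqr
  push_cast at key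
  -- For `L = k + 1` the error `5 * L + 11` is at most `16 * L`, which after division by `L³` is the
  -- summable term `16 / L²`.
  have e : (16 : ℝ) * (1 / ((k : ℝ) + 1) ^ 2) = 16 * ((k : ℝ) + 1) / ((k : ℝ) + 1) ^ 3 := by
    field_simp
  rw [e, ← add_div, ← add_div]
  refine div_le_div_of_nonneg_right ?_ (by positivity)
  linarith [(Nat.cast_nonneg k : (0 : ℝ) ≤ k)]

end Additivity

/-! ### Dual curtains of a contracting geodesic are separated -/

section Contraction

variable {X : Type*} [MetricSpace X]

/-- The sets `k⁻ ∪ k` and `k⁺ ∪ k` are connected and avoid `l` and `h` respectively, so each lies in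
a single half space. -/
theorem Curtain.Precedes.trans (hX : IsCAT0 X) {h k l : Curtain X} (hk : h.Precedes k)
    (kl : k.Precedes l) : h.Precedes l := by
  obtain ⟨w, hw⟩ := k.nonempty_carrier hX
  constructor
  · have hd : Disjoint (k.minus ∪ k.carrier) l.carrier :=
      disjoint_union_left.2 ⟨(k.disjoint_minus_plus hX).mono_right kl.2, kl.disjoint hX⟩
    exact hk.1.trans (subset_union_left.trans
      (l.subset_minus_of_disjoint hX (k.isPreconnected_minus_union hX) hd (.inr hw) (kl.1 hw)))
  · have hd : Disjoint (k.plus ∪ k.carrier) h.carrier :=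
      disjoint_union_left.2 ⟨((k.disjoint_minus_plus hX).mono_left hk.1).symm,
        (hk.disjoint hX).symm⟩
    exact kl.2.trans (subset_union_left.trans
      (h.subset_plus_of_disjoint hX (k.isPreconnected_plus_union hX) hd (.inr hw) (hk.2 hw)))

/-- The curtains of a chain can be oriented consistently. -/
theorem IsCurtainChain.exists_oriented (hX : IsCAT0 X) {n : ℕ} {c : Fin n → Curtain X}
    (hc : IsCurtainChain c) : ∃ o : Fin n → Curtain X, (∀ i, (o i).carrier = (c i).carrier) ∧
      ∀ i j, i < j → (o i).Precedes (o j) := by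
  have ho : ∀ i, ∃ o : Curtain X, o.carrier = (c i).carrier ∧
      (∀ j : Fin n, (i : ℕ) = j + 1 → (c j).carrier ⊆ o.minus) ∧
      (∀ j : Fin n, (j : ℕ) = i + 1 → (c j).carrier ⊆ o.plus) := by
    intro i
    have side : ∀ j, j ≠ i → (c j).carrier ⊆ (c i).minus ∨ (c j).carrier ⊆ (c i).plus :=
      fun j hj => (c i).subset_minus_or_subset_plus hX ((c j).isPreconnected_carrier hX)
        (hc.1 j i hj)
    -- An interior curtain is oriented by the chain condition, an end curtain by its only neighbour,
    -- and a lone curtain arbitrarily.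
    by_cases h1 : ∃ j : Fin n, (i : ℕ) = j + 1
    · obtain ⟨j, hj⟩ := h1
      have uj : ∀ j' : Fin n, (i : ℕ) = j' + 1 → j' = j := fun j' h => Fin.ext (by omega)
      by_cases h2 : ∃ k : Fin n, (k : ℕ) = i + 1
      · obtain ⟨k, hk⟩ := h2
        have uk : ∀ k' : Fin n, (k' : ℕ) = i + 1 → k' = k := fun k' h => Fin.ext (by omega)
        rcases hc.2 j i k hj hk with ⟨h3, h4⟩ | ⟨h3, h4⟩
        · exact ⟨c i, rfl, fun j' h => uj j' h ▸ h3, fun k' h => uk k' h ▸ h4⟩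
        · exact ⟨(c i).flip, (c i).flip_carrier,
            fun j' h => by rw [uj j' h, Curtain.flip_minus]; exact h3,
            fun k' h => by rw [uk k' h, Curtain.flip_plus]; exact h4⟩
      · rcases side j (fun h => by rw [h] at hj; omega) with h3 | h3
        · exact ⟨c i, rfl, fun j' h => uj j' h ▸ h3, fun k' h => (h2 ⟨k', h⟩).elim⟩
        · exact ⟨(c i).flip, (c i).flip_carrier,
            fun j' h => by rw [uj j' h, Curtain.flip_minus]; exact h3,
            fun k' h => (h2 ⟨k', h⟩).elim⟩
    · by_cases h2 : ∃ k : Fin n, (k : ℕ) = i + 1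
      · obtain ⟨k, hk⟩ := h2
        have uk : ∀ k' : Fin n, (k' : ℕ) = i + 1 → k' = k := fun k' h => Fin.ext (by omega)
        rcases side k (fun h => by rw [h] at hk; omega) with h3 | h3
        · exact ⟨(c i).flip, (c i).flip_carrier, fun j' h => (h1 ⟨j', h⟩).elim,
            fun k' h => by rw [uk k' h, Curtain.flip_plus]; exact h3⟩
        · exact ⟨c i, rfl, fun j' h => (h1 ⟨j', h⟩).elim, fun k' h => uk k' h ▸ h3⟩
      · exact ⟨c i, rfl, fun j' h => (h1 ⟨j', h⟩).elim, fun k' h => (h2 ⟨k', h⟩).elim⟩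
  choose o ho hm hp using ho
  have hstep : ∀ i j : Fin n, (j : ℕ) = i + 1 → (o i).Precedes (o j) := fun i j hij =>
    ⟨by rw [ho]; exact hm j i hij, by rw [ho]; exact hp i j hij⟩
  have hind : ∀ d : ℕ, ∀ i j : Fin n, (j : ℕ) = i + (d + 1) → (o i).Precedes (o j) := by
    intro d
    induction d with
    | zero => exact fun i j h => hstep i j h
    | succ d ih =>
      intro i j h
      have hlt : (i : ℕ) + (d + 1) < n := by omega
      exact (ih i ⟨i + (d + 1), hlt⟩ rfl).trans hX (hstep _ j (by simp only; omega))
  exact ⟨o, ho, fun i j hij => hind (j - i - 1) i j (by have := Fin.lt_def.1 hij; omega)⟩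

open Classical in
/-- A chain all of whose members have points within distance `D` of each other has at most
`D + 2` members. -/
theorem IsCurtainChain.card_le (hX : IsCAT0 X) {n : ℕ} {c : Fin n → Curtain X}
    (hc : IsCurtainChain c) {D : ℝ} (hD : 0 ≤ D) {w : Fin n → X} (hw : ∀ i, w i ∈ (c i).carrier)
    (hd : ∀ i j, dist (w i) (w j) ≤ D) : (n : ℝ) ≤ D + 2 := by
  rcases lt_or_ge n 2 with hn | hn
  · have : (n : ℝ) < 2 := by exact_mod_cast hn
    linarith
  obtain ⟨o, ho, hprec⟩ := hc.exists_oriented hX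
  have hinj : Function.Injective o := by
    have key : ∀ i j, i < j → o i ≠ o j := fun i j hij e => by
      obtain ⟨v, hv⟩ := (o i).nonempty_carrier hX
      exact disjoint_left.1 ((hprec i j hij).disjoint hX) hv (e ▸ hv)
    intro i j e
    rcases lt_trichotomy i j with h | h | h
    · exact (key i j h e).elim
    · exact h
    · exact (key j i h e.symm).elim
  let a : Fin n := ⟨0, by omega⟩
  let z : Fin n := ⟨n - 1, by omega⟩
  -- The inner curtains separate the chosen points of the two outer ones; the outer ones account for
  -- the `+ 2`.
  have hS : SeparatingFamily (w a) (w z) ((Finset.Ioo a z).image o) := by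
    refine ⟨?_, ?_, ?_⟩ <;> simp only [Finset.mem_image, Finset.mem_Ioo]
    · rintro _ ⟨i, -, rfl⟩ _ ⟨j, -, rfl⟩ hne
      rw [ho, ho]
      exact hc.1 i j fun e => hne (congrArg o e)
    · rintro _ ⟨i, hi, rfl⟩
      exact (hprec a i hi.1).1 (by rw [ho]; exact hw a)
    · rintro _ ⟨i, hi, rfl⟩
      exact (hprec i z hi.2).2 (by rw [ho]; exact hw z)
  have h1 := hS.card_le_dist hX
  rw [Finset.card_image_of_injective _ hinj, Fin.card_Ioo] at h1
  have h2 : n = (z : ℕ) - (a : ℕ) - 1 + 2 := by simp only [a, z]; omega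
  have h3 : (n : ℝ) = ((z - a - 1 : ℕ) : ℝ) + 2 := by exact_mod_cast h2
  linarith [hd a z]

variable {I : Set ℝ} {γ : ℝ → X}

/-- Points at distance `M` from the geodesic with foot at most `t` are centres of balls of radius
`M` with projections of size at most `K`. -/
def LocallyContracting (I : Set ℝ) (γ : ℝ → X) (t M K : ℝ) : Prop :=
  ∀ x y, foot I γ x ≤ t → dist x (γ (foot I γ x)) = M → dist x y < M →
    |foot I γ x - foot I γ y| ≤ K

namespace LocallyContracting

variable {t M K l : ℝ}

/-- Otherwise the midpoint lies in both balls of radius `M`, and its foot is within `K` of both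
feet, which are more than `2 * K` apart. -/
theorem two_mul_le_dist (hX : IsCAT0 X) (hc : LocallyContracting I γ t M K) (hl : 2 * K < l)
    {u v : X} (hu : foot I γ u ≤ t) (hv : foot I γ v ≤ t) (hMu : dist u (γ (foot I γ u)) = M)
    (hMv : dist v (γ (foot I γ v)) = M) (huv : |foot I γ u - foot I γ v| = l) :
    2 * M ≤ dist u v := by
  by_contra! hlt
  obtain ⟨m, hm1, hm2⟩ := hX.exists_between u v (s := dist u v / 2) (by positivity)
    (by linarith [dist_nonneg (x := u) (y := v)])
  have h1 := hc u m hu hMu (by linarith)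
  have h2 := hc v m hv hMv (by rw [dist_comm]; linarith)
  have h3 := abs_sub_le (foot I γ u) (foot I γ m) (foot I γ v)
  rw [abs_sub_comm (foot I γ m)] at h3
  linarith

end LocallyContracting

/-- The Euclidean angle at `p` comparing the triangles `p, w, y` is monotone in `y`. -/
theorem IsCAT0.angle_monotone (hX : IsCAT0 X) {p v y : X} (h : dist p y + dist y v = dist p v)
    (w : X) : dist p v * (dist w y ^ 2 - dist p y ^ 2 - dist w p ^ 2) ≤
      dist p y * (dist w v ^ 2 - dist p v ^ 2 - dist w p ^ 2) := by
  have := hX.stewart h w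
  have e : dist y v = dist p v - dist p y := by linarith
  rw [e] at this
  nlinarith

namespace IsGeodesicOn

theorem dist_foot_other_le (hg : IsGeodesicOn I γ) (u v : X) :
    dist u (γ (foot I γ v)) ≤ dist u (γ (foot I γ u)) + |foot I γ u - foot I γ v| := by
  rw [← hg.isometric _ (hg.foot_mem u) _ (hg.foot_mem v)]
  exact dist_triangle _ _ _

theorem dist_le_add (hg : IsGeodesicOn I γ) (u v : X) :
    dist u v ≤ dist u (γ (foot I γ u)) + |foot I γ u - foot I γ v| +
      dist v (γ (foot I γ v)) := by
  have := hg.dist_foot_other_le u v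
  have := dist_triangle_right u v (γ (foot I γ v))
  linarith

/-- The point at distance `M` from the geodesic on the segment from `u` to its projection. -/
theorem exists_at_height (hX : IsCAT0 X) (hg : IsGeodesicOn I γ) {u : X} {M : ℝ} (hM : 0 ≤ M)
    (hu : M ≤ dist u (γ (foot I γ u))) : ∃ y, foot I γ y = foot I γ u ∧
      dist y (γ (foot I γ u)) = M ∧
      dist (γ (foot I γ u)) y + dist y u = dist (γ (foot I γ u)) u := by
  rw [dist_comm] at hu
  obtain ⟨y, h1, h2⟩ := hX.exists_between (γ (foot I γ u)) u hM hu
  refine ⟨y, ?_, by rw [dist_comm, h1], by rw [h1, h2]; ring⟩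
  refine hg.foot_eq_of_between hX ?_
  rw [dist_comm u y, dist_comm y (γ _), dist_comm u (γ _), h1, h2]
  ring

end IsGeodesicOn

namespace LocallyContracting

variable {t M K l : ℝ}

/-- Far from a contracting geodesic, points with feet at distance `l` diverge at an angle of at
least `2π/3`. -/
theorem divergence (hX : IsCAT0 X) (hg : IsGeodesicOn I γ) (hc : LocallyContracting I γ t M K)
    (hl : 2 * K < l) (hl0 : 0 < l) (hM : M = 8 * l) {u v : X} (hu : foot I γ u ≤ t)
    (hv : foot I γ v ≤ t) (huv : |foot I γ u - foot I γ v| = l)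
    (hMu : M ≤ dist u (γ (foot I γ u))) (hMv : M ≤ dist v (γ (foot I γ v))) :
    dist u (γ (foot I γ u)) ^ 2 + dist v (γ (foot I γ v)) ^ 2 +
      dist u (γ (foot I γ u)) * dist v (γ (foot I γ v)) ≤ dist u v ^ 2 := by
  have hM0 : 0 < M := by linarith
  obtain ⟨u', hu'f, hu'd, hu'b⟩ := hg.exists_at_height hX hM0.le hMu
  obtain ⟨v', hv'f, hv'd, hv'b⟩ := hg.exists_at_height hX hM0.le hMv
  -- Contraction is used only at height `M`, where `u'` and `v'` are `2 * M` apart. Angle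
  -- monotonicity carries the obtuse angle out first to `v`, then to `u`.
  have h0 : 2 * M ≤ dist u' v' := hc.two_mul_le_dist hX hl (by rwa [hu'f]) (by rwa [hv'f])
    (by rw [hu'f, hu'd]) (by rw [hv'f, hv'd]) (by rw [hu'f, hv'f, huv])
  have a1 := hX.angle_monotone hv'b u'
  have a2 := hX.angle_monotone hu'b v
  have b1 := hg.dist_foot_other_le u' v
  have b2 := hg.dist_foot_other_le v u
  have c1 := hg.dist_foot_le u' (hg.foot_mem v)
  have c2 := hg.dist_foot_le v (hg.foot_mem u)
  rw [hu'f, hu'd, huv] at b1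
  rw [hu'f, hu'd] at c1
  rw [abs_sub_comm, huv] at b2
  rw [dist_comm (γ (foot I γ v)) v', hv'd, dist_comm (γ (foot I γ v)) v] at a1
  rw [dist_comm (γ (foot I γ u)) u', hu'd, dist_comm (γ (foot I γ u)) u, dist_comm v u',
    dist_comm v u] at a2
  set s := dist u (γ (foot I γ u))
  set s' := dist v (γ (foot I γ v))
  set h := dist u' (γ (foot I γ v))
  set h' := dist v (γ (foot I γ u))
  have hs : 0 < s := by linarith
  have hs' : 0 < s' := by linarith
  have e0 : (2 * M) ^ 2 ≤ dist u' v' ^ 2 := pow_le_pow_left₀ (by linarith) h0 2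
  have e1 : h ^ 2 ≤ (M + l) ^ 2 := pow_le_pow_left₀ (by linarith) b1 2
  have e2 : h' ^ 2 ≤ (s' + l) ^ 2 := pow_le_pow_left₀ (by linarith) b2 2
  have e3 : M ^ 2 ≤ h ^ 2 := pow_le_pow_left₀ (by linarith) c1 2
  have e4 : s' ^ 2 ≤ h' ^ 2 := pow_le_pow_left₀ (by linarith) c2 2
  have hl' : l = M / 8 := by linarith
  rw [hl'] at e1 e2
  have f1 : 111 / 64 * M ^ 2 ≤ dist u' v' ^ 2 - M ^ 2 - h ^ 2 := by linarith
  have f2 : 111 / 64 * M * s' ≤ dist u' v ^ 2 - s' ^ 2 - h ^ 2 := by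
    refine le_of_mul_le_mul_left (le_trans (le_of_eq ?_)
      ((mul_le_mul_of_nonneg_left f1 hs'.le).trans a1)) hM0
    ring
  -- Moving the apex from the foot of `v` to that of `u` costs `M * s' / 4 + M² / 64`, since the
  -- feet are only `M / 8` apart. The remaining coefficient `94 / 64` exceeds the required 1.
  have f3 : 94 / 64 * M * s' ≤ dist u' v ^ 2 - M ^ 2 - h' ^ 2 := by
    have := mul_le_mul_of_nonneg_left hMv hM0.le
    linarith
  have f4 : 94 / 64 * s * s' ≤ dist u v ^ 2 - s ^ 2 - h' ^ 2 := by
    refine le_of_mul_le_mul_left (le_trans (le_of_eq ?_)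
      ((mul_le_mul_of_nonneg_left f3 hs.le).trans a2)) hM0
    ring
  linarith [mul_pos hs hs']

/-- A segment whose projection covers an interval of length `2 * l` comes close to the geodesic over
that interval. -/
theorem exists_near (hX : IsCAT0 X) (hg : IsGeodesicOn I γ) (hc : LocallyContracting I γ t M K)
    (hl : 2 * K < l) (hl0 : 0 < l) (hM : M = 8 * l) {u v : X} {a : ℝ} (ha : a + 2 * l ≤ t)
    (hu : foot I γ u ≤ a) (hv : a + 2 * l ≤ foot I γ v) :
    ∃ w, dist u w + dist w v = dist u v ∧ dist w (γ (foot I γ w)) < M ∧ a ≤ foot I γ w ∧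
      foot I γ w ≤ a + 2 * l := by
  by_contra! hfar
  obtain ⟨α, hα, h0, h1⟩ := hX.exists_isGeodesicOn u v
  set d := dist u v
  have hd0 : 0 ≤ d := dist_nonneg
  have hcont : ContinuousOn (fun s => foot I γ (α s)) (Icc 0 d) :=
    (hg.lipschitz_foot hX).continuous.comp_continuousOn hα.continuousOn
  obtain ⟨s₁, hs₁, e₁⟩ := intermediate_value_Icc hd0 hcont
    (show a ∈ Icc _ _ by simp only [h0, h1]; constructor <;> linarith)
  obtain ⟨s₂, hs₂, e₂⟩ := intermediate_value_Icc hs₁.2 (hcont.mono (Icc_subset_Icc_left hs₁.1))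
    (show a + l ∈ Icc _ _ by simp only [e₁, h1]; constructor <;> linarith)
  have hs₂' : s₂ ∈ Icc 0 d := ⟨hs₁.1.trans hs₂.1, hs₂.2⟩
  obtain ⟨s₃, hs₃, e₃⟩ := intermediate_value_Icc hs₂.2 (hcont.mono (Icc_subset_Icc_left hs₂'.1))
    (show a + 2 * l ∈ Icc _ _ by simp only [e₂, h1]; constructor <;> linarith)
  have hs₃' : s₃ ∈ Icc 0 d := ⟨hs₂'.1.trans hs₃.1, hs₃.2⟩
  have hbet : ∀ s ∈ Icc 0 d, dist u (α s) + dist (α s) v = d := by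
    intro s hs
    have k0 := hα.isometric 0 (left_mem_Icc.2 dist_nonneg) s hs
    have k1 := hα.isometric s hs d (right_mem_Icc.2 dist_nonneg)
    rw [h0, abs_sub_comm, abs_of_nonneg (by linarith [hs.1])] at k0
    rw [h1, abs_sub_comm, abs_of_nonneg (by linarith [hs.2])] at k1
    rw [k0, k1]; ring
  have hM' : ∀ s ∈ Icc 0 d, a ≤ foot I γ (α s) → foot I γ (α s) ≤ a + 2 * l →
      M ≤ dist (α s) (γ (foot I γ (α s))) := by
    intro s hs k1 k2
    by_contra! k3
    exact absurd k2 (not_le.2 (hfar _ (hbet s hs) k3 k1))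
  simp only at e₁ e₂ e₃
  -- Three points of the segment lie over `a`, `a + l`, `a + 2 * l`. The obtuse angles force its
  -- length between the outer two to be at least `x₁ + x₂ + x₃`, whereas going via `γ` costs at most
  -- `x₁ + 2 * l + x₃`; this contradicts `x₂ ≥ 8 * l`.
  have m₁ := hM' s₁ hs₁ (by rw [e₁]) (by rw [e₁]; linarith)
  have m₂ := hM' s₂ hs₂' (by rw [e₂]; linarith) (by rw [e₂]; linarith)
  have m₃ := hM' s₃ hs₃' (by rw [e₃]; linarith) (by rw [e₃])
  have d₁₂ := hc.divergence hX hg hl hl0 hM (u := α s₁) (v := α s₂) (by rw [e₁]; linarith)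
    (by rw [e₂]; linarith)
    (by rw [e₁, e₂, show a - (a + l) = -l by ring, abs_neg, abs_of_pos hl0]) m₁ m₂
  have d₂₃ := hc.divergence hX hg hl hl0 hM (u := α s₂) (v := α s₃) (by rw [e₂]; linarith)
    (by rw [e₃]; linarith)
    (by rw [e₂, e₃, show a + l - (a + 2 * l) = -l by ring, abs_neg, abs_of_pos hl0]) m₂ m₃
  have u₁₃ := hg.dist_le_add (α s₁) (α s₃)
  have e₁₃ : |foot I γ (α s₁) - foot I γ (α s₃)| = 2 * l := by
    rw [e₁, e₃, show a - (a + 2 * l) = -(2 * l) by ring, abs_neg, abs_of_pos (by linarith)]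
  rw [e₁₃] at u₁₃
  rw [hα.isometric s₁ hs₁ s₂ hs₂', abs_sub_comm, abs_of_nonneg (by linarith [hs₂.1])] at d₁₂
  rw [hα.isometric s₂ hs₂' s₃ hs₃', abs_sub_comm, abs_of_nonneg (by linarith [hs₃.1])] at d₂₃
  rw [hα.isometric s₁ hs₁ s₃ hs₃', abs_sub_comm,
    abs_of_nonneg (by linarith [hs₂.1, hs₃.1])] at u₁₃
  set x₁ := dist (α s₁) (γ (foot I γ (α s₁)))
  set x₂ := dist (α s₂) (γ (foot I γ (α s₂)))
  set x₃ := dist (α s₃) (γ (foot I γ (α s₃)))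
  have k₁ : x₁ + x₂ / 2 ≤ s₂ - s₁ :=
    le_of_sq_le_sq (by nlinarith) (by linarith [hs₂.1])
  have k₂ : x₃ + x₂ / 2 ≤ s₃ - s₂ :=
    le_of_sq_le_sq (by nlinarith) (by linarith [hs₃.1])
  linarith

/-- A curtain that meets two far apart points over a contracting geodesic comes close to it. -/
theorem exists_near_of_curtain (hX : IsCAT0 X) (hg : IsGeodesicOn I γ)
    (hc : LocallyContracting I γ t M K) (hl : 2 * K < l) (hl0 : 0 < l) (hM : M = 8 * l)
    (c : Curtain X) {x y : X} (hx : x ∈ c.carrier) (hy : y ∈ c.carrier) {a : ℝ}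
    (ha : a + 4 * l + 1 ≤ t) (hxa : foot I γ x ≤ a) (hya : a + 4 * l + 1 ≤ foot I γ y) :
    ∃ w ∈ c.carrier, dist w (γ (foot I γ w)) < M ∧ a ≤ foot I γ w ∧
      foot I γ w ≤ a + 4 * l + 1 := by
  have hmem : ∀ x ∈ c.carrier, ∀ w, dist x w + dist w (c.γ (foot c.I c.γ x)) =
      dist x (c.γ (foot c.I c.γ x)) → w ∈ c.carrier := by
    intro x hx w hw
    rw [c.mem_carrier hX, Curtain.height] at hx ⊢
    rwa [c.isGeodesicOn.foot_eq_of_between hX hw]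
  set p := c.γ (foot c.I c.γ x)
  set q := c.γ (foot c.I c.γ y)
  -- The segments `[x, p]` and `[q, y]` stay in the curtain, and the jump across the pole moves the
  -- foot on `γ` by at most 1. So one of them covers an interval of length `2 * l`.
  have hpq : dist p q ≤ 1 := by
    rw [c.isometric _ (c.isGeodesicOn.foot_mem x) _ (c.isGeodesicOn.foot_mem y), abs_le]
    rw [c.mem_carrier hX, Curtain.height] at hx hy
    constructor <;> linarith [hx.1, hx.2, hy.1, hy.2]
  by_cases hp : a + 2 * l ≤ foot I γ p
  · obtain ⟨w, hw, hwM, hw1, hw2⟩ := hc.exists_near hX hg hl hl0 hM (a := a) (by linarith) hxa hp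
    exact ⟨w, hmem x hx w hw, hwM, hw1, by linarith⟩
  · have hf := (abs_le.1 ((hg.abs_foot_sub_le hX p q).trans hpq)).1
    obtain ⟨w, hw, hwM, hw1, hw2⟩ := hc.exists_near hX hg hl hl0 hM (a := a + 2 * l + 1)
      (u := q) (v := y) (by linarith) (by linarith) (by linarith)
    refine ⟨w, hmem y hy w ?_, hwM, by linarith, by linarith⟩
    rw [dist_comm y w, dist_comm w q, dist_comm y q, ← hw]
    ring

/-- All curtains meeting both `h` and `k` have points within `M` of `γ` over one common interval of
length `4 * l + 1`. These points are at most `2 * M + 4 * l + 1` apart, and `IsCurtainChain.card_le`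
adds 2. -/
theorem lSeparated_dual (hX : IsCAT0 X) (hg : IsGeodesicOn I γ)
    (hc : LocallyContracting I γ t M K) (hl : 2 * K < l) (hl0 : 0 < l) (hM : M = 8 * l)
    {L : ℕ} (hL : 2 * M + 4 * l + 3 ≤ L) {h k : Curtain X} (hI : h.I = I) (hγ : h.γ = γ)
    (kI : k.I = I) (kγ : k.γ = γ) (hk : h.r + (4 * l + 2) ≤ k.r) (kt : k.r ≤ t) :
    LSeparated L h k := by
  refine ⟨(Curtain.precedes_of_dual hX (hI.trans kI.symm) (hγ.trans kγ.symm)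
    (by linarith)).disjoint hX, fun n c hch hm => ?_⟩
  have hw : ∀ i, ∃ w ∈ (c i).carrier, dist w (γ (foot I γ w)) < M ∧ h.r + 1 / 2 ≤ foot I γ w ∧
      foot I γ w ≤ h.r + 1 / 2 + 4 * l + 1 := by
    intro i
    obtain ⟨⟨x, hxc, hxh⟩, y, hyc, hyk⟩ := hm i
    rw [h.mem_carrier hX, Curtain.height, hI, hγ] at hxh
    rw [k.mem_carrier hX, Curtain.height, kI, kγ] at hyk
    exact hc.exists_near_of_curtain hX hg hl hl0 hM (c i) hxc hyc (by linarith)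
      (by linarith [hxh.2]) (by linarith [hyk.1])
  choose w hwc hwM hw1 hw2 using hw
  have hcard := hch.card_le hX (D := 2 * M + 4 * l + 1) (by linarith) hwc fun i j => by
    have k1 := hg.dist_le_add (w i) (w j)
    have k3 : |foot I γ (w i) - foot I γ (w j)| ≤ 4 * l + 1 := by
      rw [abs_le]
      constructor <;> linarith [hw1 i, hw1 j, hw2 i, hw2 j]
    linarith [hwM i, hwM j]
  have : (n : ℝ) ≤ L := by linarith
  exact_mod_cast this

end LocallyContracting

end Contraction

/-! ### Contracting rays in the curtain model -/

section Rays

variable {X : Type*} [MetricSpace X] {γ : ℝ → X}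

open Classical in
/-- The dual curtains of a contracting ray form `L`-families of proportional size. -/
theorem LocallyContracting.exists_lFamily (hX : IsCAT0 X) (hg : IsGeodesicOn (Ici 0) γ)
    {t M K l : ℝ} (hc : LocallyContracting (Ici 0) γ t M K) (hl : 2 * K < l) (hl0 : 0 < l)
    (hM : M = 8 * l) {L : ℕ} (hL : 2 * M + 4 * l + 3 ≤ L) :
    ∃ S, LFamily L (γ 0) (γ t) S ∧ (t - 2) / (4 * l + 2) - 1 ≤ S.card := by
  have hD : 0 < 4 * l + 2 := by linarith
  set N := ⌊(t - 2) / (4 * l + 2)⌋₊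
  have hpos : ∀ i : ℕ, 0 ≤ (4 * l + 2) * i := fun i => by positivity
  -- The offset 1 keeps the first pole in the interior of the ray and `γ 0` strictly before it; the
  -- `- 2` in `N` leaves the same room before `γ t`.
  let r : ℕ → ℝ := fun i => 1 + (4 * l + 2) * i
  have hpole : ∀ i, Icc (r i - 1 / 2) (r i + 1 / 2) ⊆ interior (Ici (0 : ℝ)) := by
    intro i u hu
    rw [interior_Ici, mem_Ioi]
    linarith [hu.1, hpos i]
  let c : ℕ → Curtain X := fun i => hg.dual (r i) (hpole i)
  have hlt : ∀ i < N, r i + 1 < t := by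
    intro i hi
    have h1 : ((i + 1 : ℕ) : ℝ) ≤ (t - 2) / (4 * l + 2) :=
      (Nat.le_floor_iff' (Nat.succ_ne_zero i)).1 hi
    rw [le_div_iff₀ hD] at h1
    push_cast at h1
    simp only [r]
    linarith
  have hr : ∀ i j : ℕ, i < j → r i + (4 * l + 2) ≤ r j := by
    intro i j hij
    have h1 : (i : ℝ) + 1 ≤ j := by exact_mod_cast hij
    have := mul_le_mul_of_nonneg_left h1 hD.le
    simp only [r]
    linarith
  have hinj : Function.Injective c := by
    intro i j h
    have h1 : r i = r j := congrArg Curtain.r h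
    rcases lt_trichotomy i j with hij | hij | hij
    · linarith [hr i j hij]
    · exact hij
    · linarith [hr j i hij]
  have hsep : ∀ i < N, ∀ j < N, i ≠ j → LSeparated L (c i) (c j) := by
    have key : ∀ i j, i < j → j < N → LSeparated L (c i) (c j) := fun i j hij hj =>
      hc.lSeparated_dual hX hg hl hl0 hM hL rfl rfl rfl rfl (hr i j hij)
        (by have := hlt j hj; change r j ≤ t; linarith)
    intro i hi j hj hij
    rcases lt_or_gt_of_ne hij with h | h
    · exact key i j h hj
    · exact (key j i h hi).symm
  refine ⟨(Finset.range N).image c, ⟨⟨?_, ?_, ?_⟩, ?_⟩, ?_⟩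
  · simp only [Finset.mem_image, Finset.mem_range]
    rintro _ ⟨i, hi, rfl⟩ _ ⟨j, hj, rfl⟩ hne
    exact (hsep i hi j hj fun e => hne (congrArg c e)).1
  · simp only [Finset.mem_image, Finset.mem_range]
    rintro _ ⟨i, hi, rfl⟩
    rw [Curtain.mem_minus hX, Curtain.height]
    change foot (Ici 0) γ (γ 0) - r i < _
    rw [hg.foot_apply hX (mem_Ici.2 le_rfl)]
    simp only [r]
    linarith [hpos i]
  · simp only [Finset.mem_image, Finset.mem_range]
    rintro _ ⟨i, hi, rfl⟩
    have h1 := hlt i hi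
    have h2 : 0 ≤ t := by simp only [r] at h1; linarith [hpos i]
    rw [Curtain.mem_plus hX, Curtain.height]
    change _ < foot (Ici 0) γ (γ t) - r i
    rw [hg.foot_apply hX (mem_Ici.2 h2)]
    linarith
  · simp only [Finset.mem_image, Finset.mem_range]
    rintro _ ⟨i, hi, rfl⟩ _ ⟨j, hj, rfl⟩ hne
    exact hsep i hi j hj fun e => hne (congrArg c e)
  · rw [Finset.card_image_of_injective _ hinj, Finset.card_range]
    linarith [Nat.lt_floor_add_one ((t - 2) / (4 * l + 2))]

theorem IsSublinear.two_mul_le {κ : ℝ → ℝ} (hκ : IsSublinear κ) {t : ℝ} (ht : 0 ≤ t) :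
    κ (2 * t) ≤ 2 * κ t := by
  obtain ⟨-, hcc⟩ := hκ.concaveOn
  have h1 := hcc (mem_Ici.2 (le_refl (0 : ℝ))) (mem_Ici.2 (show 0 ≤ 2 * t by positivity))
    (show (0 : ℝ) ≤ 1 / 2 by norm_num) (show (0 : ℝ) ≤ 1 / 2 by norm_num) (by norm_num)
  simp only [smul_eq_mul, mul_zero, zero_add] at h1
  rw [show (1 / 2 : ℝ) * (2 * t) = t by ring] at h1
  linarith [hκ.one_le 0 le_rfl]

/-- A `κ`-contracting ray is locally contracting, with constants proportional to `κ`. -/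
theorem locallyContracting_of_contracting {κ : ℝ → ℝ} (hκ : IsSublinear κ)
    (hg : IsGeodesicOn (Ici 0) γ) {C : ℝ} (hC : 0 ≤ C)
    (hcontr : ∀ (x : X) (ρ : ℝ), 0 < ρ → Disjoint (Metric.ball x ρ) (γ '' Ici 0) →
      Metric.diam (projImage (γ '' Ici 0) (Metric.ball x ρ)) < C * κ (dist (γ 0) x))
    {t M : ℝ} (hM : 0 < M) (hMt : M ≤ t) :
    LocallyContracting (Ici 0) γ t M (2 * C * κ t) := by
  intro x y hxt hxM hxy
  have hf0 : 0 ≤ foot (Ici 0) γ x := hg.foot_mem x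
  have hdisj : Disjoint (Metric.ball x M) (γ '' Ici 0) := by
    refine disjoint_left.2 ?_
    rintro _ hs ⟨s, hs', rfl⟩
    rw [Metric.mem_ball, dist_comm] at hs
    linarith [hg.dist_foot_le x hs']
  -- `Metric.diam` of an unbounded set is `0`, so the contraction hypothesis controls distances only
  -- once the projection is known to be bounded.
  have hbdd : Bornology.IsBounded (projImage (γ '' Ici 0) (Metric.ball x M)) := by
    refine (Metric.isBounded_closedBall (x := x) (r := 3 * M)).subset ?_
    rintro p ⟨v, hv, -, hmin⟩
    rw [Metric.mem_ball] at hv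
    rw [Metric.mem_closedBall]
    have h1 := hmin _ (mem_image_of_mem γ (hg.foot_mem x))
    have h2 := dist_triangle v x (γ (foot (Ici 0) γ x))
    have h3 := dist_triangle p v x
    rw [dist_comm p v] at h3
    linarith
  have h1 := Metric.dist_le_diam_of_mem hbdd
    (hg.mem_projImage (Metric.mem_ball_self (x := x) hM))
    (hg.mem_projImage (Metric.mem_ball'.2 hxy))
  rw [hg.isometric _ (hg.foot_mem x) _ (hg.foot_mem y)] at h1
  have h2 := hcontr x M hM hdisj
  have h3 : dist (γ 0) x ≤ 2 * t := by
    have h4 := hg.isometric 0 (mem_Ici.2 le_rfl) _ (hg.foot_mem x)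
    rw [zero_sub, abs_neg, abs_of_nonneg hf0] at h4
    have h5 := dist_triangle_right (γ 0) x (γ (foot (Ici 0) γ x))
    linarith
  have h4 : κ (dist (γ 0) x) ≤ 2 * κ t :=
    (hκ.monotoneOn (mem_Ici.2 dist_nonneg) (mem_Ici.2 (by linarith)) h3).trans
      (hκ.two_mul_le (by linarith))
  linarith [mul_le_mul_of_nonneg_left h4 hC]

/-- A `κ`-contracting ray leaves every bounded subset of the curtain model if `κ ^ 4` is
sublinear. -/
theorem tendsto_dHat_ray (hX : IsCAT0 X) {κ : ℝ → ℝ} (hκ : IsSublinear κ)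
    (hκ4 : Tendsto (fun t : ℝ => κ t ^ 4 / t) atTop (𝓝 0))
    (hg : IsGeodesicOn (Ici 0) γ) (hcontr : IsContracting κ (γ 0) (γ '' Ici 0)) :
    Tendsto (fun t => dHat (γ 0) (γ t)) atTop atTop := by
  obtain ⟨C, hC, hcontr⟩ := hcontr
  have hinv : Tendsto (fun t : ℝ => (κ t ^ 4 / t)⁻¹) atTop atTop := by
    refine Tendsto.inv_tendsto_nhdsGT_zero (tendsto_nhdsWithin_iff.2 ⟨hκ4, ?_⟩)
    filter_upwards [eventually_gt_atTop 0] with t ht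
    have := hκ.one_le t ht.le
    rw [mem_Ioi]
    positivity
  -- With `K = 2 * C * κ t`, this choice makes `2 * K < A * κ t = l`. The bound on `κ t / t` below
  -- ensures `8 * l ≤ t`.
  set A : ℝ := 4 * C + 1 with hA
  have hA1 : 1 ≤ A := by linarith
  refine tendsto_atTop_mono' atTop ?_
    (hinv.const_mul_atTop (show 0 < 1 / (12 * 24 ^ 3 * A ^ 4) by positivity))
  have hev : ∀ᶠ t in atTop, κ t / t < 1 / (8 * A) :=
    hκ.tendsto.eventually_lt_const (by positivity)
  filter_upwards [hev, eventually_ge_atTop 4] with t ht ht4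
  have ht0 : 0 < t := by linarith
  have hκ1 := hκ.one_le t ht0.le
  rw [div_lt_div_iff₀ ht0 (by positivity), one_mul] at ht
  set l := A * κ t with hl
  have hl1 : 1 ≤ l := one_le_mul_of_one_le_of_one_le hA1 hκ1
  have hloc := locallyContracting_of_contracting hκ hg hC hcontr (t := t) (M := 8 * l)
    (by linarith) (by rw [hl]; linarith)
  -- For `M = 8 * l` the separation threshold `2 * M + 4 * l + 3` equals `20 * l + 3`, and `l ≥ 1`
  -- gives `L ≤ 24 * l`.
  set L := ⌈20 * l + 3⌉₊
  have hL1 : 20 * l + 3 ≤ L := Nat.le_ceil _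
  have hL2 : (L : ℝ) ≤ 24 * l := by
    linarith [Nat.ceil_lt_add_one (show 0 ≤ 20 * l + 3 by linarith)]
  have hL0 : (0 : ℝ) < L := by linarith
  obtain ⟨S, hS, hcard⟩ := hloc.exists_lFamily hX hg (l := l) (by rw [hl, hA]; linarith)
    (by linarith) rfl (L := L) (by linarith)
  have hne : γ 0 ≠ γ t := by
    rw [← dist_pos, hg.isometric 0 (mem_Ici.2 le_rfl) t (mem_Ici.2 ht0.le), zero_sub, abs_neg]
    exact abs_pos.2 ht0.ne'
  have h1 := hS.card_lt_dL hX hne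
  have h2 := dL_div_le_dHat hX (γ 0) (γ t) (L := L) (by exact_mod_cast hL0)
  refine le_trans ?_ h2
  have h3 : t / (12 * l) ≤ dL L (γ 0) (γ t) := by
    have : t / (12 * l) ≤ (t - 2) / (4 * l + 2) := by
      rw [div_le_div_iff₀ (by linarith) (by linarith)]
      nlinarith
    linarith
  -- The fourth power of `κ` arises here: one factor from the spacing of the curtains, three from
  -- the weight `1 / L³`.
  calc 1 / (12 * 24 ^ 3 * A ^ 4) * (κ t ^ 4 / t)⁻¹ = t / (12 * l) / (24 * l) ^ 3 := by
        rw [hl]; field_simp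
    _ ≤ dL L (γ 0) (γ t) / (24 * l) ^ 3 := by gcongr
    _ ≤ dL L (γ 0) (γ t) / (L : ℝ) ^ 3 := by
        have := dL_nonneg L (γ 0) (γ t)
        gcongr

theorem dL_comm (L : ℕ) (x y : X) : dL L x y = dL L y x := by
  have h : ∀ c : Curtain X, c.Separates {x} {y} ↔ c.Separates {y} {x} := fun c => by
    simp only [Curtain.Separates]; tauto
  rcases eq_or_ne x y with rfl | hne
  · rfl
  · simp only [dL, if_neg hne, if_neg hne.symm, h]

theorem dHat_comm (x y : X) : dHat x y = dHat y x := by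
  simp only [dHat, dL_comm _ x y]

theorem gromovProduct_comm (o x y : X) : gromovProduct o x y = gromovProduct o y x := by
  rw [gromovProduct, gromovProduct, dHat_comm x y, add_comm (dHat o x)]

/-- Both bounds follow from additivity at `γ s` on the way from `γ 0` to `γ t`, the second after a
triangle inequality through `γ s`. The constant is half the additivity error. -/
theorem exists_gromovProduct_bounds (hX : IsCAT0 X) (hg : IsGeodesicOn (Ici 0) γ) :
    ∃ c : ℝ, ∀ s t : ℝ, 0 ≤ s → s ≤ t →
      dHat (γ 0) (γ s) - c ≤ gromovProduct (γ 0) (γ s) (γ t) ∧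
      ∀ y, gromovProduct (γ 0) (γ s) y - c ≤ gromovProduct (γ 0) (γ t) y := by
  refine ⟨(∑' k : ℕ, 16 * (1 / ((k : ℝ) + 1) ^ 2)) / 2, fun s t hs hst => ?_⟩
  have h1 := dHat_add_le hX hg (mem_Ici.2 le_rfl) (mem_Ici.2 (hs.trans hst)) hs hst
  refine ⟨by rw [gromovProduct]; linarith, fun y => ?_⟩
  have h2 := dHat_triangle hX (γ t) (γ s) y
  rw [dHat_comm (γ t) (γ s)] at h2
  rw [gromovProduct, gromovProduct]
  linarith

/-- A ray that leaves every bounded subset of the curtain model Gromov-converges to infinity. -/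
theorem gromovConverges_ray (hX : IsCAT0 X) (hg : IsGeodesicOn (Ici 0) γ)
    (hd : Tendsto (fun t => dHat (γ 0) (γ t)) atTop atTop) {t : ℕ → ℝ} (ht : Tendsto t atTop atTop) :
    GromovConverges (γ 0) fun n => γ (t n) := by
  obtain ⟨c, hc⟩ := exists_gromovProduct_bounds hX hg
  refine tendsto_atTop.2 fun R => ?_
  obtain ⟨N, hN⟩ := eventually_atTop.1
    (((hd.comp ht).eventually_ge_atTop (R + c)).and (ht.eventually_ge_atTop 0))
  filter_upwards [eventually_ge_atTop (N, N)] with p hp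
  obtain ⟨h1, h1'⟩ := hN p.1 hp.1
  obtain ⟨h2, h2'⟩ := hN p.2 hp.2
  simp only [Function.comp_apply] at h1 h2
  rcases le_total (t p.1) (t p.2) with h | h
  · linarith [(hc _ _ h1' h).1]
  · rw [gromovProduct_comm]
    linarith [(hc _ _ h2' h).1]

/-- One sufficiently late point `γ (t m)` already has large products with all late `y j`. Points `γ
(t' n)` beyond it lose only a constant. -/
theorem gromovEquiv_ray (hX : IsCAT0 X) (hg : IsGeodesicOn (Ici 0) γ) {t t' : ℕ → ℝ}
    (ht : Tendsto t atTop atTop) (ht' : Tendsto t' atTop atTop) {y : ℕ → X}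
    (h : GromovEquiv (γ 0) (fun n => γ (t n)) y) : GromovEquiv (γ 0) (fun n => γ (t' n)) y := by
  obtain ⟨c, hc⟩ := exists_gromovProduct_bounds hX hg
  refine tendsto_atTop.2 fun R => ?_
  obtain ⟨p₀, hp₀⟩ := eventually_atTop.1 (tendsto_atTop.1 h (R + c))
  obtain ⟨m, hm, hm0⟩ := ((eventually_ge_atTop p₀.1).and (ht.eventually_ge_atTop 0)).exists
  obtain ⟨N, hN⟩ := eventually_atTop.1 (ht'.eventually_ge_atTop (t m))
  filter_upwards [eventually_ge_atTop (N, p₀.2)] with p hp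
  have h1 := hp₀ (m, p.2) ⟨hm, hp.2⟩
  have h2 := (hc _ _ hm0 (hN p.1 hp.1)).2 (y p.2)
  simp only at h1
  linarith

theorem gromovClass_ray (hX : IsCAT0 X) (hg : IsGeodesicOn (Ici 0) γ) {t t' : ℕ → ℝ}
    (ht : Tendsto t atTop atTop) (ht' : Tendsto t' atTop atTop) :
    gromovClass (γ 0) (fun n => γ (t n)) = gromovClass (γ 0) (fun n => γ (t' n)) := by
  ext y
  exact ⟨fun h => ⟨h.1, gromovEquiv_ray hX hg ht ht' h.2⟩,
    fun h => ⟨h.1, gromovEquiv_ray hX hg ht' ht h.2⟩⟩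

end Rays

end CurtainModel

/-! ### Conclusion for rays parametrised by `ℝ≥0` -/

theorem mainTheorem4 {X : Type*} [MetricSpace X] (hX : CurtainModel.IsCAT0 X)
    (κ : ℝ → ℝ) (hκ : CurtainModel.IsSublinear κ)
    (hκ4 : Tendsto (fun t : ℝ => κ t ^ 4 / t) atTop (𝓝 0))
    (o : X) (b : ℝ≥0 → X) (hb : Isometry b) (hb0 : b 0 = o)
    (hcontr : CurtainModel.IsContracting κ o (range b)) :
    CurtainModel.diamHat (range b) = ⊤ ∧
    ∃! ξ : Set (ℕ → X), ξ ∈ CurtainModel.gromovBoundary o ∧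
      ∀ t : ℕ → ℝ≥0, Tendsto t atTop atTop →
        CurtainModel.GromovConverges o (fun n => b (t n)) ∧
        CurtainModel.gromovClass o (fun n => b (t n)) = ξ := by
  open CurtainModel in
  set γ : ℝ → X := fun t => b t.toNNReal with hγ
  have hγb : ∀ t : ℝ≥0, γ t = b t := fun t => by simp only [hγ, Real.toNNReal_coe]
  have hγ0 : γ 0 = o := by rw [← hb0, ← hγb, NNReal.coe_zero]
  have hg : IsGeodesicOn (Ici 0) γ := by
    refine ⟨isClosed_Ici, ordConnected_Ici, nonempty_Ici, fun s hs t ht => ?_⟩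
    rw [hb.dist_eq, NNReal.dist_eq, Real.coe_toNNReal s hs, Real.coe_toNNReal t ht]
  have himage : γ '' Ici 0 = range b := by
    ext x
    constructor
    · rintro ⟨t, -, rfl⟩
      exact mem_range_self _
    · rintro ⟨t, rfl⟩
      exact ⟨t, t.2, hγb t⟩
  have hd : Tendsto (fun t => dHat (γ 0) (γ t)) atTop atTop :=
    tendsto_dHat_ray hX hκ hκ4 hg (by rwa [hγ0, himage])
  have hconv : ∀ t : ℕ → ℝ≥0, Tendsto t atTop atTop → GromovConverges o fun n => b (t n) := by
    intro t ht
    have := gromovConverges_ray hX hg hd (NNReal.tendsto_coe_atTop.2 ht)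
    simpa only [hγb, hγ0] using this
  have hclass : ∀ t t' : ℕ → ℝ≥0, Tendsto t atTop atTop → Tendsto t' atTop atTop →
      gromovClass o (fun n => b (t n)) = gromovClass o (fun n => b (t' n)) := by
    intro t t' ht ht'
    have := gromovClass_ray hX hg (NNReal.tendsto_coe_atTop.2 ht) (NNReal.tendsto_coe_atTop.2 ht')
    simpa only [hγb, hγ0] using this
  -- The integer times provide a representative of `ξ`, and evaluating the defining property at them
  -- gives uniqueness.
  have hnat : Tendsto (fun n : ℕ => (n : ℝ≥0)) atTop atTop := tendsto_natCast_atTop_atTop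
  refine ⟨ENNReal.eq_top_of_forall_nnreal_le fun R => ?_,
    gromovClass o fun n => b n, ⟨⟨_, hconv _ hnat, rfl⟩, fun t ht => ⟨hconv t ht, hclass _ _ ht hnat⟩⟩,
    fun ξ hξ => (hξ.2 _ hnat).2.symm⟩
  obtain ⟨t, ht⟩ := (hd.eventually_ge_atTop (R : ℝ)).exists
  refine le_iSup₂_of_le (γ 0) (mem_range_self _) (le_iSup₂_of_le (γ t) (mem_range_self _) ?_)
  rw [← ENNReal.ofReal_coe_nnreal]
  exact ENNReal.ofReal_le_ofReal ht
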